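/- Let $G$ be a locally compact (Hausdorff) group with a fixed left Haar measure, and let $S^1(G)$ be a Segal algebra in $L^1(G)$: a dense left ideal of the convolution algebra $L^1(G)$ that is invariant under the left translations $L_xf(y)=f(x^{-1}y)$, carries a complete norm $\|\cdot\|_{S}$ for which the inclusion $S^1(G)\hookrightarrow L^1(G)$ is continuous and $\|f*s\|_S\le\|f\|_1\|s\|_S$ $(f\in L^1(G),\,s\in S^1(G))$, and is essential, i.e. the linear span of $L^1(G)*S^1(G)$ is $\|\cdot\|_S$-dense in $S^1(G)$. Call $S^1(G)$ symmetric if it is moreover a right ideal of $L^1(G)$ with $\|s*f\|_S\le\|s\|_S\|f\|_1$ and the linear span of $S^1(G)*L^1(G)$ is $\|\cdot\|_S$-dense in $S^1(G)$. Let $\widehat\otimes$ denote the projective tensor product of Banach spaces. On $L^1(G)\widehat\otimes S^1(G)$ (and likewise on $S^1(G)\widehat\otimes S^1(G)$) put $f\cdot(g\otimes s)=(f*g)\otimes s$, $(g\otimes s)\cdot t=g\otimes(s*t)$ and $\pi(g\otimes s)=g*s$. A central approximate diagonal for $S^1(G)$ in $L^1(G)\widehat\otimes S^1(G)$ is a net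 $(m_\gamma)$ in $L^1(G)\widehat\otimes S^1(G)$ such that $s\cdot m_\gamma=m_\gamma\cdot s$ for all $\gamma$ and all $s\in S^1(G)$, and $(\pi(m_\gamma))$ is an approximate identity for $S^1(G)$; it is multiplier-bounded if the operators $s\mapsto s\cdot m_\gamma$ and $s\mapsto m_\gamma\cdot s$ from $S^1(G)$ to $L^1(G)\widehat\otimes S^1(G)$ are bounded uniformly in $\gamma$. The algebra $S^1(G)$ is pseudo-contractible if there is a net $(m_\gamma)$ in $S^1(G)\widehat\otimes S^1(G)$ with $s\cdot m_\gamma=m_\gamma\cdot s$ and $\pi(m_\gamma)*s\to s$ in $S^1(G)$ for all $s\in S^1(G)$. If $S^1(G)$ is symmetric, it is called a projective $L^1(G)$-bimodule if there is a bounded $L^1(G)$-bimodule map $\rho:S^1(G)\to L^1(G)\widehat\otimes S^1(G)$ with $\pi\circ\rho=\mathrm{id}_{S^1(G)}$. Then the following are equivalent: (i) $G$ is compact; (ii) $S^1(G)$ has a central approximate diagonal in $L^1(G)\widehat\otimes S^1(G)$; (iii) $S^1(G)$ is pseudo-contractible. If, in addition, $S^1(G)$ is symmetric, then these statements are also equivalent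 to each of the following: (iv) $S^1(G)$ is a projective $L^1(G)$-bimodule; (v) $S^1(G)$ has a central multiplier-bounded approximate diagonal in $L^1(G)\widehat\otimes S^1(G)$. -/

import Mathlib

open MeasureTheory Filter Topology
open scoped TensorProduct ENNReal

set_option linter.unusedSectionVars false

/-! ### The projective tensor product of Banach spaces -/

section ProjectiveTensor

/-- The algebraic tensor product `E ⊗ F`, to be equipped with the projective norm. -/
def AlgTensor (E F : Type*) [NormedAddCommGroup E] [NormedSpace ℂ E]
    [NormedAddCommGroup F] [NormedSpace ℂ F] : Type _ := E ⊗[ℂ] F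

namespace AlgTensor

variable {E F X : Type*} [NormedAddCommGroup E] [NormedSpace ℂ E]
  [NormedAddCommGroup F] [NormedSpace ℂ F] [NormedAddCommGroup X] [NormedSpace ℂ X]

noncomputable instance : AddCommGroup (AlgTensor E F) :=
  inferInstanceAs (AddCommGroup (E ⊗[ℂ] F))

noncomputable instance : Module ℂ (AlgTensor E F) :=
  inferInstanceAs (Module ℂ (E ⊗[ℂ] F))

/-- The elementary tensor `x ⊗ y`. -/
noncomputable def tmul (x : E) (y : F) : AlgTensor E F := x ⊗ₜ[ℂ] y

/-- The value `∑ x_i ⊗ y_i` of a finite list of pairs `(x_i, y_i)`. -/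
noncomputable def listSum (l : List (E × F)) : AlgTensor E F :=
  (l.map fun p => tmul p.1 p.2).sum

/-- The cost `∑ ‖x_i‖ ‖y_i‖` of a finite list of pairs `(x_i, y_i)`. -/
noncomputable def listCost (l : List (E × F)) : ℝ :=
  (l.map fun p => ‖p.1‖ * ‖p.2‖).sum

theorem listCost_nonneg (l : List (E × F)) : 0 ≤ listCost l := by
  refine List.sum_nonneg fun a ha => ?_
  obtain ⟨p, -, rfl⟩ := List.mem_map.1 ha
  positivity

theorem exists_listSum (t : AlgTensor E F) : ∃ l : List (E × F), listSum l = t := by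
  induction t using TensorProduct.induction_on with
  | zero => exact ⟨[], rfl⟩
  | tmul x y => exact ⟨[(x, y)], add_zero _⟩
  | add a b ha hb =>
    obtain ⟨l, rfl⟩ := ha
    obtain ⟨l', rfl⟩ := hb
    exact ⟨l ++ l', by simp only [listSum, List.map_append, List.sum_append]; rfl⟩

instance (t : AlgTensor E F) : Nonempty {l : List (E × F) // listSum l = t} :=
  let ⟨l, hl⟩ := exists_listSum t; ⟨⟨l, hl⟩⟩

/-- The projective norm `‖t‖ = inf ∑ ‖x_i‖ ‖y_i‖` over all representations `t = ∑ x_i ⊗ y_i`. -/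
noncomputable instance : Norm (AlgTensor E F) :=
  ⟨fun t => ⨅ l : {l : List (E × F) // listSum l = t}, listCost l.1⟩

theorem norm_le_listCost (l : List (E × F)) : ‖listSum l‖ ≤ listCost l :=
  ciInf_le (f := fun k : {k : List (E × F) // listSum k = listSum l} => listCost k.1)
    ⟨0, by rintro _ ⟨k, rfl⟩; exact listCost_nonneg _⟩ ⟨l, rfl⟩

theorem le_norm {t : AlgTensor E F} {c : ℝ} (h : ∀ l, listSum l = t → c ≤ listCost l) :
    c ≤ ‖t‖ := le_ciInf fun l => h l.1 l.2

theorem norm_zero' : ‖(0 : AlgTensor E F)‖ = 0 :=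
  le_antisymm (by simpa [listSum, listCost] using norm_le_listCost ([] : List (E × F)))
    (le_norm fun l _ => listCost_nonneg l)

theorem norm_add_le' (s t : AlgTensor E F) : ‖s + t‖ ≤ ‖s‖ + ‖t‖ := by
  refine le_ciInf_add_ciInf fun l k => ?_
  have h : listSum (l.1 ++ k.1) = s + t := by
    simp only [listSum, List.map_append, List.sum_append]
    exact congrArg₂ (· + ·) l.2 k.2
  have h' : listCost (l.1 ++ k.1) = listCost l.1 + listCost k.1 := by simp [listCost]
  rw [← h, ← h']
  exact norm_le_listCost _

theorem norm_smul_le' (a : ℂ) (t : AlgTensor E F) : ‖a • t‖ ≤ ‖a‖ * ‖t‖ := by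
  change _ ≤ ‖a‖ * ⨅ l : {l : List (E × F) // listSum l = t}, listCost l.1
  rw [Real.mul_iInf_of_nonneg (norm_nonneg _)]
  refine le_ciInf fun l => ?_
  have h : listSum (l.1.map fun p => (a • p.1, p.2)) = a • t := by
    obtain ⟨l, rfl⟩ := l
    simp only [listSum, List.map_map, List.smul_sum]
    rfl
  have h' : listCost (l.1.map fun p => (a • p.1, p.2)) = ‖a‖ * listCost l.1 := by
    simp [listCost, Function.comp_def, norm_smul, mul_assoc, List.sum_map_mul_left]
  rw [← h, ← h']
  exact norm_le_listCost _

noncomputable def projSeminorm : Seminorm ℂ (AlgTensor E F) :=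
  .ofSMulLE norm norm_zero' norm_add_le' norm_smul_le'

noncomputable instance : SeminormedAddCommGroup (AlgTensor E F) :=
  AddGroupSeminorm.toSeminormedAddCommGroup projSeminorm.toAddGroupSeminorm

noncomputable instance : NormedSpace ℂ (AlgTensor E F) := ⟨norm_smul_le'⟩

theorem norm_tmul_le (x : E) (y : F) : ‖tmul x y‖ ≤ ‖x‖ * ‖y‖ := by
  simpa [listSum, listCost] using norm_le_listCost [(x, y)]

/-- The linear map `E ⊗ F → X` induced by a bounded bilinear map. -/
noncomputable def liftLinear (B : E →L[ℂ] F →L[ℂ] X) : AlgTensor E F →ₗ[ℂ] X :=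
  let L : E ⊗[ℂ] F →ₗ[ℂ] X := TensorProduct.lift
    (LinearMap.mk₂ ℂ (fun x y => B x y) (by simp) (by simp) (by simp) (by simp))
  { toFun := fun t => L t
    map_add' := fun s t => L.map_add s t
    map_smul' := fun a t => L.map_smul a t }

theorem liftLinear_tmul (B : E →L[ℂ] F →L[ℂ] X) (x : E) (y : F) :
    liftLinear B (tmul x y) = B x y := rfl

theorem norm_liftLinear_le (B : E →L[ℂ] F →L[ℂ] X) (t : AlgTensor E F) :
    ‖liftLinear B t‖ ≤ ‖B‖ * ‖t‖ := by
  have key : ∀ l : List (E × F), ‖liftLinear B (listSum l)‖ ≤ ‖B‖ * listCost l := by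
    intro l
    induction l with
    | nil =>
      have h : (listSum [] : AlgTensor E F) = 0 := rfl
      rw [h, map_zero]
      simp [listCost]
    | cons p l ih =>
      have h1 : (listSum (p :: l) : AlgTensor E F) = tmul p.1 p.2 + listSum l := rfl
      have h2 : listCost (p :: l) = ‖p.1‖ * ‖p.2‖ + listCost l := by simp [listCost]
      rw [h1, h2, map_add, mul_add, liftLinear_tmul, ← mul_assoc]
      exact (norm_add_le _ _).trans (add_le_add (B.le_opNorm₂ p.1 p.2) ih)
  have h : ‖B‖ * ‖t‖
      = ‖B‖ * ⨅ l : {l : List (E × F) // listSum l = t}, listCost l.1 := rfl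
  rw [h, Real.mul_iInf_of_nonneg (norm_nonneg B)]
  refine le_ciInf fun l => ?_
  have := key l.1
  rwa [l.2] at this

/-- The linear map `E ⊗ F → X` induced by a bounded bilinear map, bounded for the projective
norm. -/
noncomputable def lift (B : E →L[ℂ] F →L[ℂ] X) : AlgTensor E F →L[ℂ] X :=
  (liftLinear B).mkContinuous ‖B‖ (norm_liftLinear_le B)

@[simp] theorem lift_tmul (B : E →L[ℂ] F →L[ℂ] X) (x : E) (y : F) :
    lift B (tmul x y) = B x y := rfl

end AlgTensor

/-- The projective tensor product `E ⊗̂ F`: the completion of `E ⊗ F` in the projective norm. -/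
abbrev ProjTensor (E F : Type*) [NormedAddCommGroup E] [NormedSpace ℂ E]
    [NormedAddCommGroup F] [NormedSpace ℂ F] : Type _ :=
  UniformSpace.Completion (AlgTensor E F)

namespace ProjTensor

variable {E F E' F' X : Type*} [NormedAddCommGroup E] [NormedSpace ℂ E]
  [NormedAddCommGroup F] [NormedSpace ℂ F] [NormedAddCommGroup E'] [NormedSpace ℂ E']
  [NormedAddCommGroup F'] [NormedSpace ℂ F']
  [NormedAddCommGroup X] [NormedSpace ℂ X] [CompleteSpace X]

/-- The elementary tensor `x ⊗ y` in `E ⊗̂ F`. -/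
noncomputable def tmul (x : E) (y : F) : ProjTensor E F := (AlgTensor.tmul x y : AlgTensor E F)

theorem tmul_add (x : E) (y y' : F) : tmul x (y + y') = tmul x y + tmul x y' := by
  have h : AlgTensor.tmul x (y + y') = AlgTensor.tmul x y + AlgTensor.tmul x y' :=
    TensorProduct.tmul_add x y y'
  simp only [tmul, h, UniformSpace.Completion.coe_add]

theorem add_tmul (x x' : E) (y : F) : tmul (x + x') y = tmul x y + tmul x' y := by
  have h : AlgTensor.tmul (x + x') y = AlgTensor.tmul x y + AlgTensor.tmul x' y :=
    TensorProduct.add_tmul x x' y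
  simp only [tmul, h, UniformSpace.Completion.coe_add]

theorem smul_tmul (a : ℂ) (x : E) (y : F) : tmul (a • x) y = a • tmul x y := by
  have h : AlgTensor.tmul (a • x) y = a • AlgTensor.tmul x y := rfl
  simp only [tmul, h, UniformSpace.Completion.coe_smul]

theorem tmul_smul (a : ℂ) (x : E) (y : F) : tmul x (a • y) = a • tmul x y := by
  have h : AlgTensor.tmul x (a • y) = a • AlgTensor.tmul x y := TensorProduct.tmul_smul a x y
  simp only [tmul, h, UniformSpace.Completion.coe_smul]

theorem norm_tmul_le (x : E) (y : F) : ‖tmul x y‖ ≤ 1 * ‖x‖ * ‖y‖ := by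
  rw [one_mul]
  exact (UniformSpace.Completion.norm_coe (AlgTensor.tmul x y)).trans_le
    (AlgTensor.norm_tmul_le x y)

/-- The bounded bilinear map `(x, y) ↦ x ⊗ y`. -/
noncomputable def tmulL : E →L[ℂ] F →L[ℂ] ProjTensor E F :=
  LinearMap.mkContinuous₂ (LinearMap.mk₂ ℂ tmul add_tmul smul_tmul tmul_add tmul_smul) 1
    norm_tmul_le

/-- The bounded linear map `E ⊗̂ F → X` with `x ⊗ y ↦ B x y`. -/
noncomputable def lift (B : E →L[ℂ] F →L[ℂ] X) : ProjTensor E F →L[ℂ] X :=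
  (AlgTensor.lift B).extend UniformSpace.Completion.toComplL

@[simp] theorem lift_tmul (B : E →L[ℂ] F →L[ℂ] X) (x : E) (y : F) :
    lift B (tmul x y) = B x y := by
  rw [← AlgTensor.lift_tmul B x y]
  exact ContinuousLinearMap.extend_eq _ UniformSpace.Completion.denseRange_coe
    (UniformSpace.Completion.isUniformInducing_coe _) _

/-- The bounded linear map `T ⊗ U : E ⊗̂ F → E' ⊗̂ F'`. -/
noncomputable def map (T : E →L[ℂ] E') (U : F →L[ℂ] F') : ProjTensor E F →L[ℂ] ProjTensor E' F' :=
  lift (tmulL.bilinearComp T U)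

@[simp] theorem map_tmul (T : E →L[ℂ] E') (U : F →L[ℂ] F') (x : E) (y : F) :
    map T U (tmul x y) = tmul (T x) (U y) := by
  rw [map, lift_tmul]
  rfl

end ProjTensor

end ProjectiveTensor

/-! ### Pseudo-contractible Banach algebras -/

section PseudoContractible

universe u

/-- A Banach algebra, given as a Banach space `A` with a bounded multiplication `mul`, is
pseudo-contractible: there is a net `(m γ)` in `A ⊗̂ A` with `a · m γ = m γ · a` and
`π (m γ) a → a` for all `a`, where `a · (b ⊗ c) = (a b) ⊗ c`, `(b ⊗ c) · a = b ⊗ (c a)` and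
`π (b ⊗ c) = b c`. -/
def IsPseudoContractible {A : Type u} [NormedAddCommGroup A] [NormedSpace ℂ A] [CompleteSpace A]
    (mul : A →L[ℂ] A →L[ℂ] A) : Prop :=
  ∃ (Γ : Type u) (_ : Preorder Γ) (_ : IsDirectedOrder Γ) (_ : Nonempty Γ)
    (m : Γ → ProjTensor A A),
    (∀ γ a, ProjTensor.map (mul a) (ContinuousLinearMap.id ℂ A) (m γ)
      = ProjTensor.map (ContinuousLinearMap.id ℂ A) (mul.flip a) (m γ)) ∧
    ∀ a, Tendsto (fun γ => mul (ProjTensor.lift mul (m γ)) a) atTop (𝓝 a)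

end PseudoContractible

/-! ### The group algebra -/

section GroupAlgebra

variable {G : Type*} [Group G] [TopologicalSpace G] [IsTopologicalGroup G]
  [LocallyCompactSpace G] [MeasurableSpace G] [BorelSpace G]
  (μ : Measure G) [μ.IsHaarMeasure] [μ.Regular]

/-- The space `L¹(G)` with respect to the left Haar measure `μ`. -/
abbrev LOne : Type _ := Lp ℂ 1 μ

variable {μ}

/-- The left translation `(L_x f)(y) = f (x⁻¹ y)` on `L¹(G)`. -/
noncomputable def leftTranslate (x : G) (f : LOne μ) : LOne μ :=
  DomMulAct.mk x⁻¹ • f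

theorem leftTranslate_ae_eq (x : G) (f : LOne μ) :
    leftTranslate x f =ᵐ[μ] fun y => f (x⁻¹ * y) :=
  DomMulAct.smul_Lp_ae_eq _ f

theorem norm_leftTranslate (x : G) (f : LOne μ) : ‖leftTranslate x f‖ = ‖f‖ :=
  DomMulAct.norm_smul_Lp _ f

theorem continuous_leftTranslate (f : LOne μ) : Continuous fun x : G => leftTranslate x f := by
  have : Fact ((1 : ℝ≥0∞) ≠ ∞) := ⟨ENNReal.one_ne_top⟩
  have h : Continuous fun x : G => DomMulAct.mk x⁻¹ :=
    DomMulAct.continuous_mk.comp continuous_inv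
  exact h.smul continuous_const

theorem aestronglyMeasurable_smul_continuous {X : Type*} [NormedAddCommGroup X] [NormedSpace ℂ X]
    {f : G → ℂ} (hf : Integrable f μ) {φ : G → X} (hφ : Continuous φ) :
    AEStronglyMeasurable (fun y => f y • φ y) μ := by
  refine Integrable.induction (μ := μ)
    (fun f : G → ℂ => AEStronglyMeasurable (fun y => f y • φ y) μ) ?_ ?_ ?_ ?_ hf
  · intro c s hs hsμ
    have h : (fun y => s.indicator (fun _ => c) y • φ y) = s.indicator fun y => c • φ y := by
      ext y
      by_cases hy : y ∈ s <;> simp [hy]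
    rw [h, aestronglyMeasurable_indicator_iff hs]
    have hne : ∀ n : ℕ, ((n : ℝ≥0∞) + 1)⁻¹ ≠ 0 := fun n => by simp
    choose K hKs hKc hKcl hK using fun n : ℕ =>
      hs.exists_isCompact_isClosed_sdiff_lt hsμ.ne (hne n)
    have hlim : Tendsto (fun n : ℕ => ((n : ℝ≥0∞) + 1)⁻¹) atTop (𝓝 0) := by
      have := (tendsto_add_atTop_iff_nat 1).2 ENNReal.tendsto_inv_nat_nhds_zero
      simpa using this
    have h0 : μ (s \ ⋃ n, K n) = 0 := by
      refine le_antisymm (ge_of_tendsto' hlim fun n => ?_) zero_le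
      exact (measure_mono (Set.sdiff_subset_sdiff_right (Set.subset_iUnion K n))).trans (hK n).le
    have hae : s =ᵐ[μ] ⋃ n, K n :=
      (ae_le_set.2 h0).antisymm (LE.le.eventuallyLE (Set.iUnion_subset hKs))
    rw [Measure.restrict_congr_set hae, aestronglyMeasurable_iUnion_iff]
    intro n
    exact ContinuousOn.aestronglyMeasurable_of_isCompact (by fun_prop) (hKc n)
      (hKcl n).measurableSet
  · intro f g _ _ _ h1 h2
    simp only [Pi.add_apply, add_smul]
    exact h1.add h2
  · refine IsSeqClosed.isClosed fun u v hu huv => ?_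
    obtain ⟨ns, -, hns⟩ := (tendstoInMeasure_of_tendsto_Lp huv).exists_seq_tendsto_ae
    refine aestronglyMeasurable_of_tendsto_ae atTop (fun n => hu (ns n)) ?_
    filter_upwards [hns] with y hy
    exact hy.smul_const _
  · intro f g hfg _ h
    refine h.congr ?_
    filter_upwards [hfg] with y hy
    rw [hy]

theorem integrable_smul_leftTranslate (f g : LOne μ) :
    Integrable (fun y => f y • leftTranslate y g) μ := by
  have hmeas : AEStronglyMeasurable (fun y => f y • leftTranslate y g) μ :=
    aestronglyMeasurable_smul_continuous (L1.integrable_coeFn f) (continuous_leftTranslate g)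
  refine Integrable.mono' ((L1.integrable_coeFn f).norm.mul_const ‖g‖) hmeas ?_
  filter_upwards with y
  rw [norm_smul, norm_leftTranslate]

/-- The convolution product on `L¹(G)`, `f * g = ∫ f(y) L_y g dy`, i.e.
`(f * g)(x) = ∫ f(y) g(y⁻¹ x) dy`, as a bounded bilinear map. -/
noncomputable def conv : LOne μ →L[ℂ] LOne μ →L[ℂ] LOne μ :=
  LinearMap.mkContinuous₂
    (LinearMap.mk₂ ℂ (fun f g : LOne μ => ∫ y, f y • leftTranslate y g ∂μ)
      (fun f f' g => by
        rw [← integral_add (integrable_smul_leftTranslate f g)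
          (integrable_smul_leftTranslate f' g)]
        refine integral_congr_ae ?_
        filter_upwards [Lp.coeFn_add f f'] with y hy
        rw [hy, Pi.add_apply, add_smul])
      (fun c f g => by
        rw [← integral_smul]
        refine integral_congr_ae ?_
        filter_upwards [Lp.coeFn_smul c f] with y hy
        rw [hy, Pi.smul_apply, smul_assoc])
      (fun f g g' => by
        rw [← integral_add (integrable_smul_leftTranslate f g)
          (integrable_smul_leftTranslate f g')]
        refine integral_congr_ae (Eventually.of_forall fun y => ?_)
        simp [leftTranslate, smul_add])
      (fun c f g => by
        rw [← integral_smul]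
        refine integral_congr_ae (Eventually.of_forall fun y => ?_)
        simp only [leftTranslate]
        rw [smul_comm _ c g, smul_comm _ c]))
    1 (fun f g => by
      change ‖∫ y, f y • leftTranslate y g ∂μ‖ ≤ _
      refine (norm_integral_le_integral_norm _).trans (le_of_eq ?_)
      simp only [norm_smul, norm_leftTranslate, one_mul]
      rw [integral_mul_const, ← L1.norm_eq_integral_norm f])

theorem conv_apply (f g : LOne μ) : conv f g = ∫ y, f y • leftTranslate y g ∂μ := rfl

end GroupAlgebra

/-! ### Segal algebras in `L¹(G)` -/

section Segal

universe u v

variable {G : Type u} [Group G] [TopologicalSpace G] [IsTopologicalGroup G]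
  [LocallyCompactSpace G] [MeasurableSpace G] [BorelSpace G]
  {μ : Measure G} [μ.IsHaarMeasure] [μ.Regular]
  {S : Type v} [NormedAddCommGroup S] [NormedSpace ℂ S]

/-- The Banach space `S`, identified through the inclusion `ι` with a linear subspace of `L¹(G)`
carrying its own norm, is a Segal algebra: a dense left ideal which is a contractive and
essential left `L¹(G)`-module in its norm, and which is invariant under left translations. -/
structure IsSegalAlgebra (ι : S →L[ℂ] LOne μ) : Prop where
  injective : Function.Injective ι
  denseRange : DenseRange ι
  left_ideal : ∀ (f : LOne μ) (s : S), ∃ t : S, ι t = conv f (ι s) ∧ ‖t‖ ≤ ‖f‖ * ‖s‖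
  essential : Dense (Submodule.span ℂ {t : S | ∃ f s, ι t = conv f (ι s)} : Set S)
  translation : ∀ (x : G) (s : S), ∃ t : S, ι t = leftTranslate x (ι s)

/-- The Segal algebra `S` is symmetric: it is also a right ideal, and a contractive and essential
right `L¹(G)`-module in its norm. -/
structure IsSymmetricSegalAlgebra (ι : S →L[ℂ] LOne μ) : Prop extends IsSegalAlgebra ι where
  right_ideal : ∀ (s : S) (f : LOne μ), ∃ t : S, ι t = conv (ι s) f ∧ ‖t‖ ≤ ‖s‖ * ‖f‖
  right_essential : Dense (Submodule.span ℂ {t : S | ∃ s f, ι t = conv (ι s) f} : Set S)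

namespace IsSegalAlgebra

variable {ι : S →L[ℂ] LOne μ}

/-- The product `f * s ∈ S` of `f ∈ L¹(G)` and `s ∈ S`. -/
noncomputable def leftProd (h : IsSegalAlgebra ι) (f : LOne μ) (s : S) : S :=
  (h.left_ideal f s).choose

theorem leftProd_spec (h : IsSegalAlgebra ι) (f : LOne μ) (s : S) :
    ι (h.leftProd f s) = conv f (ι s) :=
  (h.left_ideal f s).choose_spec.1

/-- The left module action `(f, s) ↦ f * s` of `L¹(G)` on `S`. -/
noncomputable def leftAct (h : IsSegalAlgebra ι) : LOne μ →L[ℂ] S →L[ℂ] S :=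
  LinearMap.mkContinuous₂
    (LinearMap.mk₂ ℂ h.leftProd
      (fun f f' s => h.injective (by simp [leftProd_spec]))
      (fun c f s => h.injective (by simp [leftProd_spec]))
      (fun f s s' => h.injective (by simp [leftProd_spec]))
      (fun c f s => h.injective (by simp [leftProd_spec])))
    1 (fun f s => by
      rw [one_mul]
      exact (h.left_ideal f s).choose_spec.2)

theorem leftAct_spec (h : IsSegalAlgebra ι) (f : LOne μ) (s : S) :
    ι (h.leftAct f s) = conv f (ι s) :=
  h.leftProd_spec f s

/-- The convolution product of the algebra `S`. -/
noncomputable def mul (h : IsSegalAlgebra ι) : S →L[ℂ] S →L[ℂ] S := h.leftAct.comp ι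

/-- The product map `π : L¹(G) ⊗̂ S → S`, `f ⊗ s ↦ f * s`. -/
noncomputable def prodMap [CompleteSpace S] (h : IsSegalAlgebra ι) :
    ProjTensor (LOne μ) S →L[ℂ] S :=
  ProjTensor.lift h.leftAct

/-- The left action `f · (g ⊗ s) = (f * g) ⊗ s` of `L¹(G)` on `L¹(G) ⊗̂ S`. -/
noncomputable def tensorLeft (_h : IsSegalAlgebra ι) (f : LOne μ) :
    ProjTensor (LOne μ) S →L[ℂ] ProjTensor (LOne μ) S :=
  ProjTensor.map (conv f) (ContinuousLinearMap.id ℂ S)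

/-- The right action `(g ⊗ s) · t = g ⊗ (s * t)` of `S` on `L¹(G) ⊗̂ S`. -/
noncomputable def tensorRight (h : IsSegalAlgebra ι) (t : S) :
    ProjTensor (LOne μ) S →L[ℂ] ProjTensor (LOne μ) S :=
  ProjTensor.map (ContinuousLinearMap.id ℂ (LOne μ)) (h.mul.flip t)

/-- The net `(m γ)` is a central approximate diagonal for `S` in `L¹(G) ⊗̂ S`:
`s · m γ = m γ · s` for all `γ` and `s`, and `(π (m γ))` is an approximate identity for `S`. -/
def IsCentralApproximateDiagonal [CompleteSpace S] (h : IsSegalAlgebra ι) {Γ : Type*}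
    [Preorder Γ] (m : Γ → ProjTensor (LOne μ) S) : Prop :=
  (∀ γ s, h.tensorLeft (ι s) (m γ) = h.tensorRight s (m γ)) ∧
  (∀ s, Tendsto (fun γ => h.mul (h.prodMap (m γ)) s) atTop (𝓝 s)) ∧
  (∀ s, Tendsto (fun γ => h.mul s (h.prodMap (m γ))) atTop (𝓝 s))

/-- `S` has a central approximate diagonal in `L¹(G) ⊗̂ S`. -/
def HasCentralApproximateDiagonal [CompleteSpace S] (h : IsSegalAlgebra ι) : Prop :=
  ∃ (Γ : Type v) (_ : Preorder Γ) (_ : IsDirectedOrder Γ) (_ : Nonempty Γ)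
    (m : Γ → ProjTensor (LOne μ) S), h.IsCentralApproximateDiagonal m

/-- `S` has a central multiplier-bounded approximate diagonal in `L¹(G) ⊗̂ S`: the operators
`s ↦ s · m γ` and `s ↦ m γ · s` from `S` to `L¹(G) ⊗̂ S` are uniformly bounded. -/
def HasCentralMultiplierBoundedApproximateDiagonal [CompleteSpace S] (h : IsSegalAlgebra ι) :
    Prop :=
  ∃ (Γ : Type v) (_ : Preorder Γ) (_ : IsDirectedOrder Γ) (_ : Nonempty Γ)
    (m : Γ → ProjTensor (LOne μ) S), h.IsCentralApproximateDiagonal m ∧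
    ∃ C : ℝ, ∀ γ s, ‖h.tensorLeft (ι s) (m γ)‖ ≤ C * ‖s‖ ∧ ‖h.tensorRight s (m γ)‖ ≤ C * ‖s‖

end IsSegalAlgebra

namespace IsSymmetricSegalAlgebra

variable {ι : S →L[ℂ] LOne μ}

/-- The product `s * f ∈ S` of `s ∈ S` and `f ∈ L¹(G)`; the arguments are in the order `f`, `s`. -/
noncomputable def rightProd (h : IsSymmetricSegalAlgebra ι) (f : LOne μ) (s : S) : S :=
  (h.right_ideal s f).choose

theorem rightProd_spec (h : IsSymmetricSegalAlgebra ι) (f : LOne μ) (s : S) :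
    ι (h.rightProd f s) = conv (ι s) f :=
  (h.right_ideal s f).choose_spec.1

/-- The right module action of `L¹(G)` on a symmetric Segal algebra: `h.rightAct f s = s * f`. -/
noncomputable def rightAct (h : IsSymmetricSegalAlgebra ι) : LOne μ →L[ℂ] S →L[ℂ] S :=
  LinearMap.mkContinuous₂
    (LinearMap.mk₂ ℂ h.rightProd
      (fun f f' s => h.injective (by simp [rightProd_spec]))
      (fun c f s => h.injective (by simp [rightProd_spec]))
      (fun f s s' => h.injective (by simp [rightProd_spec]))
      (fun c f s => h.injective (by simp [rightProd_spec])))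
    1 (fun f s => by
      rw [one_mul, mul_comm]
      exact (h.right_ideal s f).choose_spec.2)

theorem rightAct_spec (h : IsSymmetricSegalAlgebra ι) (f : LOne μ) (s : S) :
    ι (h.rightAct f s) = conv (ι s) f :=
  h.rightProd_spec f s

/-- `S` is a projective `L¹(G)`-bimodule: the product map `π : L¹(G) ⊗̂ S → S` has a bounded right
inverse `ρ` that is an `L¹(G)`-bimodule map, where `f · (g ⊗ s) = (f * g) ⊗ s` and
`(g ⊗ s) · f = g ⊗ (s * f)`. -/
def IsProjectiveBimodule [CompleteSpace S] (h : IsSymmetricSegalAlgebra ι) : Prop :=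
  ∃ ρ : S →L[ℂ] ProjTensor (LOne μ) S,
    (∀ f s, ρ (h.leftAct f s) = h.tensorLeft f (ρ s)) ∧
    (∀ f s, ρ (h.rightAct f s)
      = ProjTensor.map (ContinuousLinearMap.id ℂ (LOne μ)) (h.rightAct f) (ρ s)) ∧
    ∀ s, h.prodMap (ρ s) = s

end IsSymmetricSegalAlgebra

end Segal

/-! ### Translation, integration and convolution in `L¹(G)`. -/

section GroupAlgebraLemmas

variable {G : Type*} [Group G] [TopologicalSpace G] [IsTopologicalGroup G]
  [LocallyCompactSpace G] [MeasurableSpace G] [BorelSpace G]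
  {μ : Measure G} [μ.IsHaarMeasure] [μ.Regular]

/-- Left translation as a bounded operator on `L¹(G)`. -/
noncomputable def leftTranslateL (x : G) : LOne μ →L[ℂ] LOne μ :=
  LinearMap.mkContinuous
    { toFun := leftTranslate x
      map_add' := fun f g => by simp [leftTranslate, smul_add]
      map_smul' := fun c f => by simp only [leftTranslate, RingHom.id_apply]; rw [smul_comm] }
    1 fun f => by rw [one_mul]; exact (norm_leftTranslate x f).le

@[simp] theorem leftTranslateL_apply (x : G) (f : LOne μ) :
    leftTranslateL x f = leftTranslate x f := rfl

theorem leftTranslate_mul (x y : G) (f : LOne μ) :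
    leftTranslate (x * y) f = leftTranslate x (leftTranslate y f) := by
  rw [leftTranslate, leftTranslate, leftTranslate, ← mul_smul, ← DomMulAct.mk_mul, mul_inv_rev]

theorem leftTranslate_one (f : LOne μ) : leftTranslate 1 f = f := by
  simp [leftTranslate]

/-- Integration over the group as a bounded functional on `L¹(G)`. -/
noncomputable def augmentation (μ : Measure G) [μ.IsHaarMeasure] [μ.Regular] :
    LOne μ →L[ℂ] ℂ :=
  LinearMap.mkContinuous
    { toFun := fun f => ∫ x, f x ∂μ
      map_add' := fun f g => by
        rw [← integral_add (L1.integrable_coeFn f) (L1.integrable_coeFn g)]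
        exact integral_congr_ae (Lp.coeFn_add f g)
      map_smul' := fun c f => by
        rw [RingHom.id_apply, ← integral_smul]
        exact integral_congr_ae (Lp.coeFn_smul c f) }
    1 fun f => by
      rw [one_mul, L1.norm_eq_integral_norm]
      exact norm_integral_le_integral_norm _

theorem augmentation_apply (f : LOne μ) : augmentation μ f = ∫ x, f x ∂μ := rfl

theorem augmentation_leftTranslate (x : G) (f : LOne μ) :
    augmentation μ (leftTranslate x f) = augmentation μ f := by
  rw [augmentation_apply, augmentation_apply, integral_congr_ae (leftTranslate_ae_eq x f)]
  exact integral_mul_left_eq_self (fun y => f y) x⁻¹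

/-- Bounded operators can be moved inside the convolution integral. -/
theorem map_conv {X : Type*} [NormedAddCommGroup X] [NormedSpace ℂ X] [CompleteSpace X]
    (T : LOne μ →L[ℂ] X) (f g : LOne μ) :
    T (conv f g) = ∫ y, f y • T (leftTranslate y g) ∂μ := by
  rw [conv_apply, ← T.integral_comp_comm (integrable_smul_leftTranslate f g)]
  simp

theorem augmentation_conv (f g : LOne μ) :
    augmentation μ (conv f g) = augmentation μ f * augmentation μ g := by
  rw [map_conv]
  simp only [augmentation_leftTranslate, smul_eq_mul]
  rw [integral_mul_const, augmentation_apply f]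

theorem norm_conv_le (f g : LOne μ) : ‖conv f g‖ ≤ ‖f‖ * ‖g‖ := by
  rw [conv_apply]
  refine (norm_integral_le_integral_norm _).trans (le_of_eq ?_)
  simp only [norm_smul, norm_leftTranslate]
  rw [integral_mul_const, ← L1.norm_eq_integral_norm f]

theorem conv_leftTranslate_left (x : G) (f g : LOne μ) :
    conv (leftTranslate x f) g = leftTranslate x (conv f g) := by
  rw [← leftTranslateL_apply x (conv f g), map_conv]
  rw [conv_apply]
  have h : ∫ y, (leftTranslate x f) y • leftTranslate y g ∂μ
      = ∫ y, f (x⁻¹ * y) • leftTranslate (x * (x⁻¹ * y)) g ∂μ := by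
    refine integral_congr_ae ?_
    filter_upwards [leftTranslate_ae_eq x f] with y hy
    rw [hy, mul_inv_cancel_left]
  rw [h, integral_mul_left_eq_self (fun y => f y • leftTranslate (x * y) g) x⁻¹]
  simp only [leftTranslate_mul, leftTranslateL_apply]
  rfl

/-- Convolving on the right by `h` is a bounded operator commuting with left translations, so it
passes under the integral defining `f * g`; Fubini is not needed. -/
theorem conv_assoc (f g h : LOne μ) : conv (conv f g) h = conv f (conv g h) := by
  have := map_conv ((conv (μ := μ)).flip h) f g
  simp only [ContinuousLinearMap.flip_apply, conv_leftTranslate_left] at this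
  rw [this]
  exact (conv_apply f (conv g h)).symm

/-- Since `∫ w = 1`, the difference is `∫ w(y) (L_y f - f) dy`, and only `y ∈ V` contribute. -/
theorem norm_conv_sub_le {w f : LOne μ} {V : Set G} {ε : ℝ}
    (hV : ∀ y ∈ V, ‖leftTranslate y f - f‖ ≤ ε) (hwV : ∀ᵐ y ∂μ, y ∉ V → w y = 0)
    (hw : augmentation μ w = 1) (hw1 : ‖w‖ ≤ 1) (hε : 0 ≤ ε) : ‖conv w f - f‖ ≤ ε := by
  have h1 : f = ∫ y, w y • f ∂μ := by
    rw [integral_smul_const, ← augmentation_apply, hw, one_smul]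
  have h2 : conv w f - f = ∫ y, w y • (leftTranslate y f - f) ∂μ := by
    conv_lhs => rw [conv_apply]; rhs; rw [h1]
    rw [← integral_sub (integrable_smul_leftTranslate w f)
      ((L1.integrable_coeFn w).smul_const f)]
    simp only [smul_sub]
  rw [h2]
  refine (norm_integral_le_of_norm_le
    ((L1.integrable_coeFn w).norm.mul_const ε) ?_).trans ?_
  · filter_upwards [hwV] with y hy
    rw [norm_smul]
    by_cases hyV : y ∈ V
    · exact mul_le_mul_of_nonneg_left (hV y hyV) (norm_nonneg _)
    · simp [hy hyV]
  · rw [integral_mul_const, ← L1.norm_eq_integral_norm]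
    exact mul_le_of_le_one_left hε hw1

theorem leftTranslate_near (f : LOne μ) {ε : ℝ} (hε : 0 < ε) :
    ∀ᶠ y in 𝓝 (1 : G), ‖leftTranslate y f - f‖ ≤ ε := by
  have h : Tendsto (fun y : G => ‖leftTranslate y f - f‖) (𝓝 1) (𝓝 0) := by
    have := ((continuous_leftTranslate f).sub (continuous_const (y := f))).norm.tendsto (1 : G)
    simpa [leftTranslate_one] using this
  exact h.eventually (eventually_le_nhds hε)

end GroupAlgebraLemmas
-- Functoriality and norm bounds for the projective tensor product.
namespace ProjTensor

variable {E F E' F' E'' F'' X Y : Type*} [NormedAddCommGroup E] [NormedSpace ℂ E]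
  [NormedAddCommGroup F] [NormedSpace ℂ F] [NormedAddCommGroup E'] [NormedSpace ℂ E']
  [NormedAddCommGroup F'] [NormedSpace ℂ F'] [NormedAddCommGroup E''] [NormedSpace ℂ E'']
  [NormedAddCommGroup F''] [NormedSpace ℂ F'']
  [NormedAddCommGroup X] [NormedSpace ℂ X] [CompleteSpace X]
  [NormedAddCommGroup Y] [NormedSpace ℂ Y] [CompleteSpace Y]

theorem norm_tmul_le' (x : E) (y : F) : ‖tmul x y‖ ≤ ‖x‖ * ‖y‖ := by
  simpa using norm_tmul_le x y

@[simp] theorem tmulL_apply (x : E) (y : F) : tmulL x y = tmul x y := rfl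

theorem induction {p : ProjTensor E F → Prop} (hp : IsClosed {t | p t}) (h0 : p 0)
    (htmul : ∀ x y, p (tmul x y)) (hadd : ∀ s t, p s → p t → p (s + t)) (t : ProjTensor E F) :
    p t := by
  refine UniformSpace.Completion.induction_on t hp fun a => ?_
  obtain ⟨l, rfl⟩ := AlgTensor.exists_listSum a
  induction l with
  | nil => exact h0
  | cons q l ih =>
    have h : (AlgTensor.listSum (q :: l) : AlgTensor E F)
      = AlgTensor.tmul q.1 q.2 + AlgTensor.listSum l := rfl
    rw [h, UniformSpace.Completion.coe_add]
    exact hadd _ _ (htmul _ _) ih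

theorem ext_clm {T U : ProjTensor E F →L[ℂ] X} (h : ∀ x y, T (tmul x y) = U (tmul x y)) :
    T = U := by
  ext t
  refine induction (p := fun t => T t = U t) (isClosed_eq T.continuous U.continuous) ?_ h ?_ t
  · simp
  · intro s t hs ht
    rw [map_add, map_add, hs, ht]

theorem norm_lift_le (B : E →L[ℂ] F →L[ℂ] X) (t : ProjTensor E F) :
    ‖lift B t‖ ≤ ‖B‖ * ‖t‖ := by
  refine UniformSpace.Completion.induction_on t
    (isClosed_le (lift B).continuous.norm (continuous_const.mul continuous_norm)) fun a => ?_
  have h : lift B (a : ProjTensor E F) = AlgTensor.lift B a :=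
    ContinuousLinearMap.extend_eq _ UniformSpace.Completion.denseRange_coe
      (UniformSpace.Completion.isUniformInducing_coe _) _
  have h' : ‖(a : ProjTensor E F)‖ = ‖a‖ := UniformSpace.Completion.norm_coe a
  rw [h, h']
  exact AlgTensor.norm_liftLinear_le B a

theorem norm_map_le (T : E →L[ℂ] E') (U : F →L[ℂ] F') (t : ProjTensor E F) :
    ‖map T U t‖ ≤ ‖T‖ * ‖U‖ * ‖t‖ := by
  refine (norm_lift_le _ t).trans (mul_le_mul_of_nonneg_right ?_ (norm_nonneg t))
  refine ContinuousLinearMap.opNorm_le_bound₂ _ (by positivity) fun x y => ?_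
  refine (norm_tmul_le' (T x) (U y)).trans ?_
  calc ‖T x‖ * ‖U y‖ ≤ (‖T‖ * ‖x‖) * (‖U‖ * ‖y‖) :=
        mul_le_mul (T.le_opNorm x) (U.le_opNorm y) (norm_nonneg _) (by positivity)
    _ = ‖T‖ * ‖U‖ * ‖x‖ * ‖y‖ := by ring

theorem map_map (T : E →L[ℂ] E') (U : F →L[ℂ] F') (T' : E' →L[ℂ] E'') (U' : F' →L[ℂ] F'')
    (t : ProjTensor E F) : map T' U' (map T U t) = map (T'.comp T) (U'.comp U) t := by
  have h : (map T' U').comp (map T U) = map (T'.comp T) (U'.comp U) :=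
    ext_clm fun x y => by simp
  exact DFunLike.congr_fun h t

theorem map_id (t : ProjTensor E F) :
    map (ContinuousLinearMap.id ℂ E) (ContinuousLinearMap.id ℂ F) t = t := by
  have h : map (ContinuousLinearMap.id ℂ E) (ContinuousLinearMap.id ℂ F)
    = ContinuousLinearMap.id ℂ _ := ext_clm fun x y => by simp
  exact DFunLike.congr_fun h t

theorem map_add_left (T T' : E →L[ℂ] E') (U : F →L[ℂ] F') (t : ProjTensor E F) :
    map (T + T') U t = map T U t + map T' U t := by
  have h : map (T + T') U = map T U + map T' U :=
    ext_clm fun x y => by simp [add_tmul]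
  exact DFunLike.congr_fun h t

theorem clm_lift (R : X →L[ℂ] Y) (B : E →L[ℂ] F →L[ℂ] X) (C : E →L[ℂ] F →L[ℂ] Y)
    (h : ∀ x y, R (B x y) = C x y) (t : ProjTensor E F) : R (lift B t) = lift C t := by
  have h : R.comp (lift B) = lift C := ext_clm fun x y => by simp [h]
  exact DFunLike.congr_fun h t

theorem lift_map (B : E' →L[ℂ] F' →L[ℂ] X) (T : E →L[ℂ] E') (U : F →L[ℂ] F')
    (t : ProjTensor E F) : lift B (map T U t) = lift (B.bilinearComp T U) t := by
  have h : (lift B).comp (map T U) = lift (B.bilinearComp T U) := ext_clm fun x y => by simp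
  exact DFunLike.congr_fun h t

end ProjTensor

/-! ### Tightness of tensors and translation to infinity. -/

section Noncompact

variable {G : Type*} [Group G] [TopologicalSpace G] [IsTopologicalGroup G]
  [LocallyCompactSpace G] [MeasurableSpace G] [BorelSpace G]
  {μ : Measure G} [μ.IsHaarMeasure] [μ.Regular]

/-- Multiplication of an element of `L¹(G)` by the indicator function of `K`. -/
noncomputable def truncateFun {K : Set G} (hK : MeasurableSet K) (f : LOne μ) : LOne μ :=
  MemLp.toLp (K.indicator fun x => f x) ((Lp.memLp f).indicator hK)

theorem truncateFun_ae_eq {K : Set G} (hK : MeasurableSet K) (f : LOne μ) :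
    truncateFun hK f =ᵐ[μ] K.indicator fun x => f x := by
  have h : MemLp (K.indicator fun x => f x) 1 μ := (Lp.memLp f).indicator hK
  exact MemLp.coeFn_toLp h

theorem truncateFun_add {K : Set G} (hK : MeasurableSet K) (f g : LOne μ) :
    truncateFun hK (f + g) = truncateFun hK f + truncateFun hK g := by
  refine Lp.ext ?_
  filter_upwards [truncateFun_ae_eq hK (f + g), truncateFun_ae_eq hK f, truncateFun_ae_eq hK g,
    Lp.coeFn_add f g, Lp.coeFn_add (truncateFun hK f) (truncateFun hK g)] with x h1 h2 h3 h4 h5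
  rw [h1, h5, Pi.add_apply, h2, h3]
  by_cases h : x ∈ K
  · rw [Set.indicator_of_mem h, Set.indicator_of_mem h, Set.indicator_of_mem h, h4, Pi.add_apply]
  · simp [h]

theorem truncateFun_smul {K : Set G} (hK : MeasurableSet K) (c : ℂ) (f : LOne μ) :
    truncateFun hK (c • f) = c • truncateFun hK f := by
  refine Lp.ext ?_
  filter_upwards [truncateFun_ae_eq hK (c • f), truncateFun_ae_eq hK f,
    Lp.coeFn_smul c f, Lp.coeFn_smul c (truncateFun hK f)] with x h1 h2 h4 h5
  rw [h1, h5, Pi.smul_apply, h2]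
  by_cases h : x ∈ K
  · rw [Set.indicator_of_mem h, Set.indicator_of_mem h, h4, Pi.smul_apply]
  · simp [h]

theorem norm_truncateFun_le {K : Set G} (hK : MeasurableSet K) (f : LOne μ) :
    ‖truncateFun hK f‖ ≤ ‖f‖ := by
  refine Lp.norm_le_norm_of_ae_le ?_
  filter_upwards [truncateFun_ae_eq hK f] with x hx
  exact hx ▸ norm_indicator_le_norm_self _ _

/-- Multiplication by the indicator function of `K` as a bounded operator on `L¹(G)`. -/
noncomputable def truncate {K : Set G} (hK : MeasurableSet K) : LOne μ →L[ℂ] LOne μ :=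
  LinearMap.mkContinuous
    { toFun := truncateFun hK
      map_add' := truncateFun_add hK
      map_smul' := truncateFun_smul hK }
    1 fun f => (norm_truncateFun_le hK f).trans (one_mul _).ge

theorem truncate_ae_eq {K : Set G} (hK : MeasurableSet K) (f : LOne μ) :
    truncate hK f =ᵐ[μ] K.indicator fun x => f x :=
  truncateFun_ae_eq hK f

theorem norm_truncate_le {K : Set G} (hK : MeasurableSet K) :
    ‖(truncate hK : LOne μ →L[ℂ] LOne μ)‖ ≤ 1 :=
  LinearMap.mkContinuous_norm_le _ zero_le_one _

theorem truncate_add_truncate_compl {K : Set G} (hK : MeasurableSet K) :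
    truncate hK + truncate hK.compl = ContinuousLinearMap.id ℂ (LOne μ) := by
  ext1 f
  refine Lp.ext ?_
  filter_upwards [Lp.coeFn_add (truncate hK f) (truncate hK.compl f), truncate_ae_eq hK f,
    truncate_ae_eq hK.compl f] with x h1 h2 h3
  change (truncate hK f + truncate hK.compl f) x = f x
  rw [h1, Pi.add_apply, h2, h3]
  by_cases h : x ∈ K <;> simp [h]

theorem truncate_leftTranslate_truncate {K : Set G} (hK : MeasurableSet K) {x : G}
    (hx : ∀ y ∈ K, x⁻¹ * y ∉ K) (f : LOne μ) :
    truncate hK (leftTranslate x (truncate hK f)) = 0 := by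
  refine Lp.ext ?_
  have h : ∀ᵐ y ∂μ, truncate hK f (x⁻¹ * y) = K.indicator (fun z => f z) (x⁻¹ * y) :=
    (measurePreserving_mul_left μ x⁻¹).quasiMeasurePreserving.ae (truncate_ae_eq hK f)
  filter_upwards [truncate_ae_eq hK (leftTranslate x (truncate hK f)),
    leftTranslate_ae_eq x (truncate hK f), h, Lp.coeFn_zero ℂ 1 μ] with y h1 h2 h3 h4
  rw [h1, h4]
  by_cases hy : y ∈ K
  · simp [hy, h2, h3, hx y hy]
  · simp [hy]

/-- Tightness, from inner regularity on indicator functions. Allowing every measurable `K ⊇ K₀` lets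
the compact sets of several functions be merged. -/
theorem exists_norm_truncate_compl_le (f : LOne μ) {ε : ℝ} (hε : 0 < ε) :
    ∃ K₀ : Set G, IsCompact K₀ ∧
      ∀ (K : Set G) (hK : MeasurableSet K), K₀ ⊆ K → ‖truncate hK.compl f‖ ≤ ε := by
  revert ε
  refine Lp.induction ENNReal.one_ne_top (motive := fun f : LOne μ => ∀ {ε : ℝ}, 0 < ε →
    ∃ K₀ : Set G, IsCompact K₀ ∧
      ∀ (K : Set G) (hK : MeasurableSet K), K₀ ⊆ K → ‖truncate hK.compl f‖ ≤ ε) ?_ ?_ ?_ f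
  · intro c s hs hμs ε hε
    obtain ⟨K₀, hK₀s, hK₀, -, hlt⟩ := hs.exists_isCompact_isClosed_sdiff_lt hμs.ne
      (ε := ENNReal.ofReal (ε / (‖c‖ + 1))) (by simp; positivity)
    refine ⟨K₀, hK₀, fun K hK hsub => ?_⟩
    rw [Lp.simpleFunc.coe_indicatorConst, L1.norm_eq_integral_norm]
    have h : ∀ᵐ x ∂μ, ‖truncate hK.compl (indicatorConstLp 1 hs hμs.ne c) x‖
        = (s \ K).indicator (fun _ => ‖c‖) x := by
      filter_upwards [truncate_ae_eq hK.compl (indicatorConstLp 1 hs hμs.ne c),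
        indicatorConstLp_coeFn (p := 1) (hs := hs) (hμs := hμs.ne) (c := c)] with x h1 h2
      rw [h1]
      by_cases hx : x ∈ K <;> by_cases hxs : x ∈ s <;> simp [hx, hxs, h2]
    rw [integral_congr_ae h, integral_indicator (hs.diff hK), setIntegral_const, smul_eq_mul]
    have h1 : μ.real (s \ K) ≤ ε / (‖c‖ + 1) :=
      ENNReal.toReal_le_of_le_ofReal (by positivity)
        ((measure_mono (Set.sdiff_subset_sdiff_right hsub)).trans hlt.le)
    calc μ.real (s \ K) * ‖c‖ ≤ ε / (‖c‖ + 1) * (‖c‖ + 1) := by gcongr; linarith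
      _ = ε := div_mul_cancel₀ _ (by positivity)
  · intro f g hf hg _ h1 h2 ε hε
    obtain ⟨K₀, hK₀, h⟩ := h1 (ε := ε / 2) (by positivity)
    obtain ⟨K₁, hK₁, h'⟩ := h2 (ε := ε / 2) (by positivity)
    refine ⟨K₀ ∪ K₁, hK₀.union hK₁, fun K hK hsub => ?_⟩
    rw [map_add]
    have h1 := h K hK (Set.subset_union_left.trans hsub)
    have h2 := h' K hK (Set.subset_union_right.trans hsub)
    exact (norm_add_le _ _).trans (by linarith)
  · refine isClosed_of_closure_subset fun t ht ε hε => ?_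
    obtain ⟨s, hs, hst⟩ := Metric.mem_closure_iff.1 ht (ε / 2) (by positivity)
    obtain ⟨K₀, hK₀, h⟩ := hs (ε := ε / 2) (by positivity)
    refine ⟨K₀, hK₀, fun K hK hsub => ?_⟩
    have h1 := h K hK hsub
    have h2 : ‖truncate hK.compl (t - s)‖ ≤ ‖t - s‖ :=
      norm_truncateFun_le hK.compl _
    rw [map_sub, ← dist_eq_norm t s] at h2
    have h3 := norm_le_insert' (truncate hK.compl t) (truncate hK.compl s)
    linarith

variable {X : Type*} [NormedAddCommGroup X] [NormedSpace ℂ X]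

/-- Truncation in the first variable is a contraction of the projective norm, so tightness is a
closed condition and need only be checked on elementary tensors and sums. -/
theorem exists_norm_map_truncate_compl_le (t : ProjTensor (LOne μ) X) :
    ∀ {ε : ℝ}, 0 < ε → ∃ K₀ : Set G, IsCompact K₀ ∧
      ∀ (K : Set G) (hK : MeasurableSet K), K₀ ⊆ K →
        ‖ProjTensor.map (truncate hK.compl) (ContinuousLinearMap.id ℂ X) t‖ ≤ ε := by
  have hbound : ∀ (K : Set G) (hK : MeasurableSet K) (t : ProjTensor (LOne μ) X),
      ‖ProjTensor.map (truncate hK) (ContinuousLinearMap.id ℂ X) t‖ ≤ ‖t‖ := by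
    intro K hK t
    refine (ProjTensor.norm_map_le _ _ t).trans (mul_le_of_le_one_left (norm_nonneg t) ?_)
    exact mul_le_one₀ (norm_truncate_le hK) (norm_nonneg _) ContinuousLinearMap.norm_id_le
  induction t using ProjTensor.induction with
  | hp =>
    refine isClosed_of_closure_subset fun t ht ε hε => ?_
    obtain ⟨s, hs, hst⟩ := Metric.mem_closure_iff.1 ht (ε / 2) (by positivity)
    obtain ⟨K₀, hK₀, h⟩ := hs (ε := ε / 2) (by positivity)
    refine ⟨K₀, hK₀, fun K hK hsub => ?_⟩
    have h1 := h K hK hsub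
    have h2 := hbound _ hK.compl (t - s)
    rw [map_sub] at h2
    replace h2 := h2.trans (dist_eq_norm t s).ge
    have h3 := norm_le_insert' (ProjTensor.map (truncate hK.compl) (ContinuousLinearMap.id ℂ X) t)
      (ProjTensor.map (truncate hK.compl) (ContinuousLinearMap.id ℂ X) s)
    exact h3.trans ((add_le_add h1 (h2.trans hst.le)).trans (add_halves ε).le)
  | h0 => exact fun {ε} hε => ⟨∅, isCompact_empty, fun K hK _ => by
      rw [map_zero]; exact norm_zero.le.trans hε.le⟩
  | htmul f x =>
    intro ε hε
    obtain ⟨K₀, hK₀, h⟩ := exists_norm_truncate_compl_le f (ε := ε / (‖x‖ + 1)) (by positivity)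
    refine ⟨K₀, hK₀, fun K hK hsub => ?_⟩
    rw [ProjTensor.map_tmul]
    refine (ProjTensor.norm_tmul_le' _ _).trans ?_
    calc _ ≤ ε / (‖x‖ + 1) * (‖x‖ + 1) :=
          mul_le_mul (h K hK hsub) (by simp) (norm_nonneg _) (by positivity)
      _ = ε := div_mul_cancel₀ _ (by positivity)
  | hadd s t hs ht =>
    intro ε hε
    obtain ⟨K₀, hK₀, h⟩ := hs (ε := ε / 2) (by positivity)
    obtain ⟨K₁, hK₁, h'⟩ := ht (ε := ε / 2) (by positivity)
    refine ⟨K₀ ∪ K₁, hK₀.union hK₁, fun K hK hsub => ?_⟩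
    rw [map_add]
    have h1 := h K hK (Set.subset_union_left.trans hsub)
    have h2 := h' K hK (Set.subset_union_right.trans hsub)
    exact (norm_add_le _ _).trans ((add_le_add h1 h2).trans (add_halves ε).le)

open scoped Pointwise in
theorem exists_translate_disjoint [NoncompactSpace G] {K : Set G} (hK : IsCompact K) :
    ∃ x : G, ∀ y ∈ K, x⁻¹ * y ∉ K := by
  obtain ⟨x, hx⟩ := (Set.ne_univ_iff_exists_notMem (K * K⁻¹)).1 (hK.mul hK.inv).ne_univ
  refine ⟨x, fun y hy hxy => hx ⟨y, hy, (x⁻¹ * y)⁻¹, Set.inv_mem_inv.2 hxy, ?_⟩⟩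
  simp

/-- On a noncompact group, a tensor in `L¹(G) ⊗̂ X` all of whose left translates are obtained from
a single tensor by bounded operators on `X` is zero. -/
theorem eq_zero_of_forall_translate_eq_map [NoncompactSpace G] (a m : ProjTensor (LOne μ) X)
    (C : ℝ) (h : ∀ x : G, ∃ U : X →L[ℂ] X, ‖U‖ ≤ C ∧
      ProjTensor.map (leftTranslateL x) (ContinuousLinearMap.id ℂ X) a
        = ProjTensor.map (ContinuousLinearMap.id ℂ (LOne μ)) U m) : a = 0 := by
  set I := ContinuousLinearMap.id ℂ X with hI
  have hI1 : ‖I‖ ≤ 1 := ContinuousLinearMap.norm_id_le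
  have hC : 0 ≤ C := by
    obtain ⟨U, hU, -⟩ := h 1
    exact (norm_nonneg U).trans hU
  have hL : ∀ x : G, ‖(leftTranslateL x : LOne μ →L[ℂ] LOne μ)‖ ≤ 1 := fun x =>
    LinearMap.mkContinuous_norm_le _ zero_le_one _
  refine norm_le_zero_iff.1 (le_of_forall_pos_le_add fun ε hε => ?_)
  -- `L_x a` is concentrated over `x K` because `a` is so over `K`, and over `K` because it equals
  -- `(id ⊗ U) m`. If `x K` misses `K`, both its part over `K` and its part off `K` are small.
  obtain ⟨K₁, hK₁, h₁⟩ := exists_norm_map_truncate_compl_le a (ε := ε / 2) (by positivity)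
  obtain ⟨K₂, hK₂, h₂⟩ := exists_norm_map_truncate_compl_le m (ε := ε / 2 / (C + 1))
    (by positivity)
  -- Without a Hausdorff assumption compact sets need not be closed; the closure stays compact and
  -- is measurable.
  have hKc : IsCompact (closure (K₁ ∪ K₂)) := (hK₁.union hK₂).closure
  have hK : MeasurableSet (closure (K₁ ∪ K₂)) := isClosed_closure.measurableSet
  set K := closure (K₁ ∪ K₂)
  replace h₁ := h₁ K hK (Set.subset_union_left.trans subset_closure)
  replace h₂ := h₂ K hK (Set.subset_union_right.trans subset_closure)
  obtain ⟨x, hx⟩ := exists_translate_disjoint hKc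
  obtain ⟨U, hU, hUm⟩ := h x
  set b := ProjTensor.map (leftTranslateL x) I a with hb
  have hab : ‖a‖ ≤ ‖b‖ := by
    have : a = ProjTensor.map (leftTranslateL x⁻¹) I b := by
      rw [hb, ProjTensor.map_map]
      have h1 : (leftTranslateL x⁻¹).comp (leftTranslateL x)
          = ContinuousLinearMap.id ℂ (LOne μ) := by
        ext1 f
        simp [← leftTranslate_mul, leftTranslate_one]
      rw [h1, hI, ContinuousLinearMap.id_comp, ProjTensor.map_id]
    rw [this]
    exact (ProjTensor.norm_map_le _ _ _).trans (mul_le_of_le_one_left (norm_nonneg _)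
      (mul_le_one₀ (hL _) (norm_nonneg _) hI1))
  have hb1 : ‖ProjTensor.map (truncate hK) I b‖ ≤ ε / 2 := by
    have h1 : (truncate hK).comp (leftTranslateL x)
        = ((truncate hK).comp (leftTranslateL x)).comp (truncate hK.compl : LOne μ →L[ℂ] _) := by
      ext1 f
      have h2 : f = truncate hK f + truncate hK.compl f :=
        (DFunLike.congr_fun (truncate_add_truncate_compl hK) f).symm
      change truncate hK (leftTranslateL x f) = truncate hK (leftTranslateL x (truncate hK.compl f))
      conv_lhs => rw [h2, map_add, map_add]
      rw [leftTranslateL_apply, truncate_leftTranslate_truncate hK hx, zero_add]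
    rw [hb, ProjTensor.map_map, h1, ← ContinuousLinearMap.id_comp (I.comp I), hI,
      ContinuousLinearMap.id_comp, ← ProjTensor.map_map]
    refine (ProjTensor.norm_map_le _ _ _).trans ((mul_le_of_le_one_left (norm_nonneg _)
      (mul_le_one₀ ?_ (norm_nonneg _) hI1)).trans h₁)
    exact (ContinuousLinearMap.opNorm_comp_le _ _).trans
      (mul_le_one₀ (norm_truncate_le hK) (norm_nonneg _) (hL x))
  -- Truncation acts on the first factor and `U` on the second, so they commute and the tightness of
  -- `m` gives the bound uniformly in `x`.
  have hb2 : ‖ProjTensor.map (truncate hK.compl) I b‖ ≤ ε / 2 := by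
    have h1 : ProjTensor.map (truncate hK.compl) I b
        = ProjTensor.map (ContinuousLinearMap.id ℂ (LOne μ)) U
          (ProjTensor.map (truncate hK.compl) I m) := by
      rw [hUm, ProjTensor.map_map, ProjTensor.map_map]
      rfl
    rw [h1]
    calc _ ≤ ‖ContinuousLinearMap.id ℂ (LOne μ)‖ * ‖U‖
            * ‖ProjTensor.map (truncate hK.compl) I m‖ := ProjTensor.norm_map_le _ _ _
      _ ≤ (1 * C) * (ε / 2 / (C + 1)) := by
          gcongr
          exact ContinuousLinearMap.norm_id_le
      _ ≤ (C + 1) * (ε / 2 / (C + 1)) := by gcongr; linarith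
      _ = ε / 2 := mul_div_cancel₀ _ (by positivity)
  have hb3 : b = ProjTensor.map (truncate hK) I b + ProjTensor.map (truncate hK.compl) I b := by
    rw [← ProjTensor.map_add_left, truncate_add_truncate_compl, ProjTensor.map_id]
  rw [zero_add]
  refine hab.trans ?_
  rw [hb3]
  exact (norm_add_le _ _).trans ((add_le_add hb1 hb2).trans (add_halves ε).le)

end Noncompact

/-! ### Bounded left approximate units of `L¹(G)`. -/

section ApproximateUnits

universe u v

variable {G : Type u} [Group G] [TopologicalSpace G] [IsTopologicalGroup G]
  [LocallyCompactSpace G] [MeasurableSpace G] [BorelSpace G]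
  {μ : Measure G} [μ.IsHaarMeasure] [μ.Regular]

/-- A filter on `L¹(G)` along which the elements are bounded by `C` and form a left approximate
unit. -/
structure IsLeftApproximateUnit (C : ℝ) (ℱ : Filter (LOne μ)) : Prop where
  neBot : ℱ.NeBot
  bounded : ∀ᶠ w in ℱ, ‖w‖ ≤ C
  tendsto : ∀ f : LOne μ, Tendsto (fun w => conv w f) ℱ (𝓝 f)

/-- `w` is concentrated on `V`, has integral `1`, and has norm at most `1`. -/
structure IsBump (V : Set G) (w : LOne μ) : Prop where
  ae_eq_zero : ∀ᵐ y ∂μ, y ∉ V → w y = 0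
  augmentation_eq : augmentation μ w = 1
  norm_le : ‖w‖ ≤ 1

/-- The filter is generated by the sets of bumps in `A` on `V`, as `V` shrinks to `1`. The set `A`
serves to choose the bumps among class functions. -/
theorem exists_isLeftApproximateUnit_of_bump {A : Set (LOne μ)}
    (hA : ∀ V ∈ 𝓝 (1 : G), ∃ w ∈ A, IsBump V w) :
    ∃ ℱ : Filter (LOne μ), IsLeftApproximateUnit 1 ℱ ∧ ∀ᶠ w in ℱ, w ∈ A := by
  have hmono : Monotone fun V : Set G => {w : LOne μ | w ∈ A ∧ IsBump V w} :=
    fun V W hVW w hw => ⟨hw.1, hw.2.ae_eq_zero.mono fun y hy hyW => hy fun h => hyW (hVW h),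
      hw.2.augmentation_eq, hw.2.norm_le⟩
  have hmem : ∀ V ∈ 𝓝 (1 : G), ∀ᶠ w in (𝓝 (1 : G)).lift' fun V => {w | w ∈ A ∧ IsBump V w},
      w ∈ A ∧ IsBump V w := fun V hV => mem_lift' hV
  refine ⟨(𝓝 (1 : G)).lift' fun V => {w | w ∈ A ∧ IsBump V w}, ⟨?_, ?_, fun f => ?_⟩, ?_⟩
  · exact (lift'_neBot_iff hmono).2 hA
  · exact (hmem _ univ_mem).mono fun w hw => hw.2.norm_le
  · refine Metric.nhds_basis_closedBall.tendsto_right_iff.2 fun ε hε => ?_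
    filter_upwards [hmem _ (leftTranslate_near f hε)] with w hw
    rw [mem_closedBall_iff_norm]
    exact norm_conv_sub_le (fun y hy => hy) hw.2.ae_eq_zero hw.2.augmentation_eq hw.2.norm_le hε.le
  · exact (hmem _ univ_mem).mono fun w hw => hw.1

theorem exists_isBump {V : Set G} (hV : V ∈ 𝓝 (1 : G)) : ∃ w : LOne μ, IsBump V w := by
  obtain ⟨K, ⟨hK, hKc, hKcl⟩, hsub⟩ := (isCompact_isClosed_basis_nhds (1 : G)).mem_iff.1 hV
  have hpos : 0 < μ.real K :=
    ENNReal.toReal_pos (Measure.measure_pos_of_mem_nhds μ hK).ne' hKc.measure_ne_top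
  have hcoe := indicatorConstLp_coeFn (p := 1) (hs := hKcl.measurableSet)
    (hμs := hKc.measure_ne_top (μ := μ)) (c := ((μ.real K)⁻¹ : ℂ))
  refine ⟨indicatorConstLp 1 hKcl.measurableSet hKc.measure_ne_top ((μ.real K)⁻¹ : ℂ),
    ?_, ?_, ?_⟩
  · filter_upwards [hcoe] with y hy hyK
    rw [hy, Set.indicator_of_notMem fun h => hyK (hsub h)]
  · rw [augmentation_apply, integral_congr_ae hcoe, integral_indicator hKcl.measurableSet,
      setIntegral_const, Complex.real_smul]
    exact mul_inv_cancel₀ (by exact_mod_cast hpos.ne')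
  · rw [norm_indicatorConstLp one_ne_zero ENNReal.one_ne_top]
    simp [abs_of_pos hpos, hpos.ne']

variable (μ) in
theorem exists_isLeftApproximateUnit :
    ∃ ℱ : Filter (LOne μ), IsLeftApproximateUnit 1 ℱ := by
  obtain ⟨ℱ, hℱ, -⟩ := exists_isLeftApproximateUnit_of_bump (A := (Set.univ : Set (LOne μ)))
    fun V hV => by simpa using exists_isBump hV
  exact ⟨ℱ, hℱ⟩

theorem eq_zero_of_forall_conv_eq_zero {k : LOne μ} (h : ∀ f, conv f k = 0) : k = 0 := by
  obtain ⟨ℱ, hℱ⟩ := exists_isLeftApproximateUnit μ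
  have := hℱ.neBot
  have h1 := hℱ.tendsto k
  simp only [h] at h1
  exact (tendsto_nhds_unique tendsto_const_nhds h1).symm

/-- Members of an approximate unit may be perturbed into `A`: as `w ↦ w * f` is continuous,
closeness of `w * f` to `f` persists on a neighbourhood of `w`, which is what `ℱ.bind 𝓝` records. -/
theorem IsLeftApproximateUnit.of_mem_closure {C C' : ℝ} {ℱ : Filter (LOne μ)}
    (hℱ : IsLeftApproximateUnit C ℱ) {A : Set (LOne μ)} (hA : ∀ w ∈ A, ‖w‖ ≤ C')
    (hℱA : ∀ᶠ w in ℱ, w ∈ closure A) : IsLeftApproximateUnit C' (ℱ.bind 𝓝 ⊓ 𝓟 A) := by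
  have := hℱ.neBot
  refine ⟨inf_principal_neBot_iff.2 fun U hU => ?_, ?_, fun f => ?_⟩
  · obtain ⟨w, hw, hwA⟩ := ((show ∀ᶠ w in ℱ, U ∈ 𝓝 w from mem_bind'.1 hU).and hℱA).exists
    exact mem_closure_iff_nhds.1 hwA U hw
  · exact mem_inf_of_right (mem_principal.2 hA)
  · refine Tendsto.mono_left ?_ inf_le_left
    refine (nhds_basis_opens f).tendsto_right_iff.2 fun O hO => ?_
    have hopen : IsOpen {w : LOne μ | conv w f ∈ O} :=
      hO.2.preimage ((conv (μ := μ)).flip f).continuous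
    refine mem_bind'.2 ?_
    filter_upwards [(hℱ.tendsto f).eventually (hO.2.mem_nhds hO.1)] with w hw
    exact hopen.mem_nhds hw

end ApproximateUnits
-- Central diagonals and projectivity force compactness.
section SegalConverse

universe u v

variable {G : Type u} [Group G] [TopologicalSpace G] [IsTopologicalGroup G]
  [LocallyCompactSpace G] [MeasurableSpace G] [BorelSpace G]
  {μ : Measure G} [μ.IsHaarMeasure] [μ.Regular]
  {S : Type v} [NormedAddCommGroup S] [NormedSpace ℂ S] {ι : S →L[ℂ] LOne μ}

namespace IsSegalAlgebra

theorem mul_apply (h : IsSegalAlgebra ι) (s t : S) : h.mul s t = h.leftAct (ι s) t := rfl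

theorem mul_spec (h : IsSegalAlgebra ι) (s t : S) : ι (h.mul s t) = conv (ι s) (ι t) :=
  h.leftAct_spec _ _

theorem leftAct_conv (h : IsSegalAlgebra ι) (f g : LOne μ) (s : S) :
    h.leftAct (conv f g) s = h.leftAct f (h.leftAct g s) :=
  h.injective (by simp only [leftAct_spec, conv_assoc])

theorem norm_leftAct_le (h : IsSegalAlgebra ι) (f : LOne μ) (s : S) :
    ‖h.leftAct f s‖ ≤ ‖f‖ * ‖s‖ :=
  (h.left_ideal f s).choose_spec.2

variable [CompleteSpace S]

theorem prodMap_tensorLeft (h : IsSegalAlgebra ι) (f : LOne μ) (m : ProjTensor (LOne μ) S) :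
    h.prodMap (h.tensorLeft f m) = h.leftAct f (h.prodMap m) := by
  rw [prodMap, tensorLeft, ProjTensor.lift_map]
  refine (ProjTensor.clm_lift _ _ _ (fun g s => ?_) m).symm
  simp [leftAct_conv]

theorem prodMap_tensorRight (h : IsSegalAlgebra ι) (t : S) (m : ProjTensor (LOne μ) S) :
    h.prodMap (h.tensorRight t m) = h.mul (h.prodMap m) t := by
  rw [prodMap, tensorRight, ProjTensor.lift_map]
  refine (ProjTensor.clm_lift (h.mul.flip t) _ _ (fun g s => ?_) m).symm
  simp [mul_apply, leftAct_spec, leftAct_conv]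

/-- For central `m` a one-sided approximate identity is therefore two-sided. -/
theorem mul_prodMap_comm (h : IsSegalAlgebra ι) {m : ProjTensor (LOne μ) S} {s : S}
    (hm : h.tensorLeft (ι s) m = h.tensorRight s m) :
    h.mul s (h.prodMap m) = h.mul (h.prodMap m) s := by
  rw [mul_apply, ← prodMap_tensorLeft, hm, prodMap_tensorRight]

theorem hasCentralApproximateDiagonal_of_isPseudoContractible (h : IsSegalAlgebra ι)
    (hP : IsPseudoContractible h.mul) : h.HasCentralApproximateDiagonal := by
  obtain ⟨Γ, hΓ₁, hΓ₂, hΓ₃, m, hm, hlim⟩ := hP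
  have hcentral : ∀ γ s,
      h.tensorLeft (ι s) (ProjTensor.map ι (ContinuousLinearMap.id ℂ S) (m γ))
        = h.tensorRight s (ProjTensor.map ι (ContinuousLinearMap.id ℂ S) (m γ)) := by
    intro γ s
    have h1 : (conv (ι s)).comp ι = ι.comp (h.mul s) := by
      ext1 t
      exact (h.mul_spec s t).symm
    have h2 := congrArg (ProjTensor.map ι (ContinuousLinearMap.id ℂ S)) (hm γ s)
    rw [ProjTensor.map_map, ProjTensor.map_map] at h2
    rw [tensorLeft, tensorRight, ProjTensor.map_map, ProjTensor.map_map, h1]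
    exact h2
  have hprod : ∀ γ, h.prodMap (ProjTensor.map ι (ContinuousLinearMap.id ℂ S) (m γ))
      = ProjTensor.lift h.mul (m γ) := fun γ => ProjTensor.lift_map _ _ _ _
  have hleft : ∀ s, Tendsto (fun γ => h.mul (h.prodMap
      (ProjTensor.map ι (ContinuousLinearMap.id ℂ S) (m γ))) s) atTop (𝓝 s) := by
    simpa only [hprod] using hlim
  refine ⟨Γ, hΓ₁, hΓ₂, hΓ₃, _, hcentral, hleft, fun s => ?_⟩
  simpa only [fun γ => h.mul_prodMap_comm (hcentral γ s)] using hleft s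

/-- By density, integration would otherwise vanish on all of `L¹(G)`, including the indicator
function of a compact neighbourhood of `1`. -/
theorem exists_augmentation_eq_one (h : IsSegalAlgebra ι) : ∃ s, augmentation μ (ι s) = 1 := by
  by_contra! hne
  have h0 : ∀ s, augmentation μ (ι s) = 0 := fun s => by
    by_contra hs
    exact hne ((augmentation μ (ι s))⁻¹ • s) (by simp [hs])
  have h1 : ∀ f : LOne μ, augmentation μ f = 0 := fun f =>
    h.denseRange.induction_on (p := fun f : LOne μ => augmentation μ f = 0) f
      (isClosed_eq (augmentation μ).continuous continuous_const) h0
  obtain ⟨K, hK, hKc, hKcl⟩ := exists_mem_nhds_isCompact_isClosed (1 : G)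
  have h2 := h1 (indicatorConstLp 1 hKcl.measurableSet hKc.measure_ne_top 1)
  have hpos : 0 < μ.real K :=
    ENNReal.toReal_pos (Measure.measure_pos_of_mem_nhds μ hK).ne' hKc.measure_ne_top
  rw [augmentation_apply, integral_congr_ae indicatorConstLp_coeFn,
    integral_indicator hKcl.measurableSet, setIntegral_const] at h2
  simp [hpos.ne'] at h2

theorem compactSpace_of_hasCentralApproximateDiagonal (h : IsSegalAlgebra ι)
    (hD : h.HasCentralApproximateDiagonal) : CompactSpace G := by
  by_contra hG
  have : NoncompactSpace G := not_compactSpace_iff.1 hG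
  obtain ⟨Γ, hΓ₁, hΓ₂, hΓ₃, m, hm, -, hlim⟩ := hD
  have key : ∀ γ s, h.mul s (h.prodMap (m γ)) = 0 := by
    intro γ s
    -- In `L¹(G) ⊗̂ L¹(G)` the element `L_x s` visibly has the norm of `s`, so right convolution by
    -- it is bounded by a constant independent of `x`.
    set m' := ProjTensor.map (ContinuousLinearMap.id ℂ (LOne μ)) ι (m γ) with hm'
    have h0 : ProjTensor.map (conv (ι s)) (ContinuousLinearMap.id ℂ (LOne μ)) m' = 0 := by
      refine eq_zero_of_forall_translate_eq_map _ m' ‖ι s‖ fun x => ?_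
      obtain ⟨t, ht⟩ := h.translation x s
      refine ⟨(conv (μ := μ)).flip (ι t), ?_, ?_⟩
      · refine ContinuousLinearMap.opNorm_le_bound _ (norm_nonneg _) fun f => ?_
        rw [ContinuousLinearMap.flip_apply, mul_comm, ht, ← norm_leftTranslate x (ι s)]
        exact norm_conv_le _ _
      · have h1 : (leftTranslateL x).comp (conv (ι s)) = conv (ι t) := by
          ext1 f
          rw [ht, conv_leftTranslate_left]
          rfl
        have h2 : ι.comp (h.mul.flip t) = ((conv (μ := μ)).flip (ι t)).comp ι := by
          ext1 u
          exact h.mul_spec u t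
        have h3 := congrArg (ProjTensor.map (ContinuousLinearMap.id ℂ (LOne μ)) ι) (hm γ t)
        rw [tensorLeft, tensorRight, ProjTensor.map_map, ProjTensor.map_map, h2] at h3
        rw [ProjTensor.map_map, h1, hm', ProjTensor.map_map, ProjTensor.map_map]
        exact h3
    have h1 : ProjTensor.lift conv (ProjTensor.map (conv (ι s))
        (ContinuousLinearMap.id ℂ (LOne μ)) m') = ι (h.mul s (h.prodMap (m γ))) := by
      rw [hm', ProjTensor.map_map, ProjTensor.lift_map, mul_apply, ← prodMap_tensorLeft,
        prodMap, tensorLeft, ProjTensor.lift_map]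
      refine (ProjTensor.clm_lift _ _ _ (fun f t => ?_) (m γ)).symm
      exact h.leftAct_spec _ _
    rw [h0, map_zero] at h1
    exact h.injective (h1.symm.trans (map_zero ι).symm)
  obtain ⟨s, hs⟩ := h.exists_augmentation_eq_one
  have h1 := hlim s
  simp only [key] at h1
  rw [← tendsto_nhds_unique tendsto_const_nhds h1, map_zero, map_zero] at hs
  exact zero_ne_one hs

end IsSegalAlgebra

/-- A nonzero left translation invariant element of `L¹(G)` exists only on compact groups. -/
theorem eq_zero_of_forall_leftTranslate_eq [NoncompactSpace G] {k : LOne μ}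
    (hk : ∀ x : G, leftTranslate x k = k) : k = 0 := by
  have h0 : ProjTensor.tmul k (1 : ℂ) = 0 := by
    refine eq_zero_of_forall_translate_eq_map _ (ProjTensor.tmul k (1 : ℂ)) 1 fun x =>
      ⟨ContinuousLinearMap.id ℂ ℂ, ContinuousLinearMap.norm_id_le, ?_⟩
    rw [ProjTensor.map_tmul, ProjTensor.map_tmul, leftTranslateL_apply, hk]
    rfl
  have h1 := ProjTensor.lift_tmul ((ContinuousLinearMap.lsmul ℂ ℂ (E := LOne μ)).flip) k (1 : ℂ)
  rw [h0, map_zero] at h1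
  simpa using h1.symm

namespace IsSymmetricSegalAlgebra

variable [CompleteSpace S]

theorem compactSpace_of_isProjectiveBimodule (h : IsSymmetricSegalAlgebra ι)
    (hP : h.IsProjectiveBimodule) : CompactSpace G := by
  by_contra hG
  have : NoncompactSpace G := not_compactSpace_iff.1 hG
  obtain ⟨ρ, hl, hr, hπ⟩ := hP
  set φ := augmentation μ with hφ
  let B : LOne μ →L[ℂ] S →L[ℂ] LOne μ :=
    (ContinuousLinearMap.lsmul ℂ ℂ (E := LOne μ)).flip.bilinearComp
      (ContinuousLinearMap.id ℂ (LOne μ)) (φ.comp ι)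
  have hB : ∀ f s, B f s = φ (ι s) • f := fun f s => rfl
  -- `σ = (id ⊗ ∫) ∘ ρ`: still a left module map, while on the right `f` now acts through the scalar
  -- `∫ f`.
  let σ : S →L[ℂ] LOne μ := (ProjTensor.lift B).comp ρ
  have hσr : ∀ f s, σ (h.rightAct f s) = φ f • σ s := by
    intro f s
    change ProjTensor.lift B (ρ (h.rightAct f s)) = φ f • ProjTensor.lift B (ρ s)
    rw [hr, ProjTensor.lift_map]
    refine (ProjTensor.clm_lift (φ f • ContinuousLinearMap.id ℂ (LOne μ)) _ _
      (fun g t => ?_) (ρ s)).symm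
    change φ f • (B g t) = B g (h.rightAct f t)
    rw [hB, hB, h.rightAct_spec, hφ, augmentation_conv, smul_smul, mul_comm]
  have hσl : ∀ f s, σ (h.leftAct f s) = conv f (σ s) := by
    intro f s
    change ProjTensor.lift B (ρ (h.leftAct f s)) = conv f (ProjTensor.lift B (ρ s))
    rw [hl, IsSegalAlgebra.tensorLeft, ProjTensor.lift_map]
    refine (ProjTensor.clm_lift (conv f) _ _ (fun g t => ?_) (ρ s)).symm
    change conv f (B g t) = B (conv f g) t
    rw [hB, hB, map_smul]
  have hφσ : ∀ s, φ (σ s) = φ (ι s) := by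
    intro s
    conv_rhs => rw [← hπ s]
    let C : LOne μ →L[ℂ] S →L[ℂ] ℂ :=
      (ContinuousLinearMap.lsmul ℂ ℂ (E := ℂ)).bilinearComp φ (φ.comp ι)
    have h1 : φ (ProjTensor.lift B (ρ s)) = ProjTensor.lift C (ρ s) := by
      refine ProjTensor.clm_lift φ B C (fun g t => ?_) (ρ s)
      rw [hB, map_smul, smul_eq_mul, mul_comm]
      rfl
    have h2 : (φ.comp ι) (h.prodMap (ρ s)) = ProjTensor.lift C (ρ s) := by
      refine ProjTensor.clm_lift (φ.comp ι) _ C (fun g t => ?_) (ρ s)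
      change φ (ι (h.leftAct g t)) = φ g * φ (ι t)
      rw [h.leftAct_spec, hφ, augmentation_conv]
    exact h1.trans h2.symm
  obtain ⟨t, ht⟩ : ∃ t, φ (ι t) = 1 := h.exists_augmentation_eq_one
  set k := σ t with hk
  -- Evaluate `σ (s * t)` in two ways: `(∫ t) σ(s) = σ(s)` from the right, `s * σ(t) = s * k` from
  -- the left.
  have h1 : ∀ s, σ s = conv (ι s) k := by
    intro s
    rw [hk, ← hσl]
    have : h.leftAct (ι s) t = h.rightAct (ι t) s :=
      h.injective (by rw [h.leftAct_spec, h.rightAct_spec])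
    rw [this, hσr, ht, one_smul]
  -- After convolving on the left with `s ∈ S`, both sides equal `σ (s * f)`; `S` is dense and
  -- `L¹(G)` has left approximate units.
  have h2 : ∀ f, conv f k = φ f • k := by
    intro f
    rw [← sub_eq_zero]
    refine eq_zero_of_forall_conv_eq_zero fun g => ?_
    refine h.denseRange.induction_on
      (p := fun g : LOne μ => conv g (conv f k - φ f • k) = 0) g
      (isClosed_eq (((conv (μ := μ)).flip (conv f k - φ f • k)).continuous) continuous_const)
      fun s => ?_
    rw [map_sub, map_smul, ← conv_assoc, ← h1 s, ← hσr, h1, h.rightAct_spec, sub_self]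
  have h3 : ∀ x : G, leftTranslate x k = k := by
    intro x
    have := h2 (leftTranslate x (ι t))
    rwa [hφ, conv_leftTranslate_left, augmentation_leftTranslate, ← hφ, h2, ht, one_smul] at this
  have h4 : φ k = 1 := by rw [hk, hφσ, ht]
  rw [eq_zero_of_forall_leftTranslate_eq h3, map_zero] at h4
  exact zero_ne_one h4

end IsSymmetricSegalAlgebra

end SegalConverse
-- A Segal algebra as an essential module with continuous translations.
section SegalModule

universe u v

variable {G : Type u} [Group G] [TopologicalSpace G] [IsTopologicalGroup G]
  [LocallyCompactSpace G] [MeasurableSpace G] [BorelSpace G]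
  {μ : Measure G} [μ.IsHaarMeasure] [μ.Regular]
  {S : Type v} [NormedAddCommGroup S] [NormedSpace ℂ S] {ι : S →L[ℂ] LOne μ}

namespace IsSegalAlgebra

/-- On products, `w * (f * s) = (w * f) * s` converges because `w * f → f` in `L¹(G)`; essentiality
and the bound on `w` extend this to all of `S`. -/
theorem tendsto_leftAct (h : IsSegalAlgebra ι) {C : ℝ} {ℱ : Filter (LOne μ)}
    (hℱ : IsLeftApproximateUnit C ℱ) (s : S) :
    Tendsto (fun w => h.leftAct w s) ℱ (𝓝 s) := by
  have := hℱ.neBot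
  have hC : 0 ≤ C := by
    obtain ⟨w, hw⟩ := hℱ.bounded.exists
    exact (norm_nonneg w).trans hw
  have hspan : ∀ s ∈ Submodule.span ℂ {t : S | ∃ f s, ι t = conv f (ι s)},
      Tendsto (fun w => h.leftAct w s) ℱ (𝓝 s) := by
    intro s hs
    induction hs using Submodule.span_induction with
    | mem t ht =>
      obtain ⟨f, s, ht⟩ := ht
      have h1 : t = h.leftAct f s := h.injective (by rw [ht, leftAct_spec])
      have h2 : ∀ w, h.leftAct w t = h.leftAct.flip s (conv w f) := fun w => by
        rw [h1, ← leftAct_conv]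
        rfl
      simp only [h2]
      have h3 := ((h.leftAct.flip s).continuous.tendsto f).comp (hℱ.tendsto f)
      rw [h1]
      exact h3
    | zero => simp
    | add s t _ _ hs ht => simpa using hs.add ht
    | smul c s _ hs => simpa using hs.const_smul c
  refine Metric.tendsto_nhds.2 fun ε hε => ?_
  obtain ⟨t, ht, hst⟩ := Metric.mem_closure_iff.1 (h.essential s) (ε / (2 * (C + 2)))
    (by positivity)
  have h2 := Metric.tendsto_nhds.1 (hspan t ht) (ε / 2) (by positivity)
  filter_upwards [h2, hℱ.bounded] with w hw hwC
  rw [dist_eq_norm] at hw hst ⊢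
  have h3 : h.leftAct w s - s = h.leftAct w (s - t) + (h.leftAct w t - t) - (s - t) := by
    rw [map_sub]; abel
  have h4 : ‖h.leftAct w (s - t)‖ ≤ C * ‖s - t‖ :=
    (h.norm_leftAct_le _ _).trans (mul_le_mul_of_nonneg_right hwC (norm_nonneg _))
  have h5 : (C + 2) * ‖s - t‖ < ε / 2 := by
    rw [lt_div_iff₀ (by positivity)] at hst
    linarith
  rw [h3]
  refine (norm_sub_le _ _).trans_lt ?_
  have h6 := norm_add_le (h.leftAct w (s - t)) (h.leftAct w t - t)
  have h7 := norm_nonneg (s - t)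
  linarith

theorem exists_leftAct_near (h : IsSegalAlgebra ι) (s : S) {ε : ℝ} (hε : 0 < ε) :
    ∃ w : LOne μ, ‖w‖ ≤ 1 ∧ ‖h.leftAct w s - s‖ < ε := by
  obtain ⟨ℱ, hℱ⟩ := exists_isLeftApproximateUnit μ
  have := hℱ.neBot
  obtain ⟨w, hw, hw'⟩ :=
    (hℱ.bounded.and (Metric.tendsto_nhds.1 (h.tendsto_leftAct hℱ s) ε hε)).exists
  exact ⟨w, hw, by rwa [← dist_eq_norm]⟩

variable [CompleteSpace S]

/-- The left translate of an element of a Segal algebra. -/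
noncomputable def translateFun (h : IsSegalAlgebra ι) (x : G) (s : S) : S :=
  (h.translation x s).choose

theorem translateFun_spec (h : IsSegalAlgebra ι) (x : G) (s : S) :
    ι (h.translateFun x s) = leftTranslateL x (ι s) :=
  (h.translation x s).choose_spec

/-- Left translation on a Segal algebra as a linear map. -/
noncomputable def translateLinear (h : IsSegalAlgebra ι) (x : G) : S →ₗ[ℂ] S where
  toFun := h.translateFun x
  map_add' s t := h.injective (by simp only [map_add, translateFun_spec])
  map_smul' c s := h.injective (by simp only [map_smul, translateFun_spec, RingHom.id_apply])

theorem translateLinear_spec (h : IsSegalAlgebra ι) (x : G) (s : S) :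
    ι (h.translateLinear x s) = leftTranslate x (ι s) :=
  h.translateFun_spec x s

/-- Left translation on a Segal algebra as a bounded operator. -/
noncomputable def translate (h : IsSegalAlgebra ι) (x : G) : S →L[ℂ] S :=
  -- The graph is closed because translation is continuous on `L¹(G)` and `ι` is injective.
  ContinuousLinearMap.ofSeqClosedGraph (g := h.translateLinear x) fun u s t hu hv => by
    refine h.injective ?_
    rw [translateLinear_spec]
    have h1 := (ι.continuous.tendsto t).comp hv
    have h2 := (((leftTranslateL x).comp ι).continuous.tendsto s).comp hu
    refine tendsto_nhds_unique h1 (h2.congr fun n => ?_)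
    exact (h.translateLinear_spec x (u n)).symm

theorem translate_spec (h : IsSegalAlgebra ι) (x : G) (s : S) :
    ι (h.translate x s) = leftTranslate x (ι s) :=
  h.translateLinear_spec x s

theorem translate_mul (h : IsSegalAlgebra ι) (x y : G) (s : S) :
    h.translate (x * y) s = h.translate x (h.translate y s) :=
  h.injective (by simp only [translate_spec, leftTranslate_mul])

theorem translate_leftAct (h : IsSegalAlgebra ι) (x : G) (f : LOne μ) (s : S) :
    h.translate x (h.leftAct f s) = h.leftAct (leftTranslate x f) s :=
  h.injective (by simp only [translate_spec, leftAct_spec, conv_leftTranslate_left])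

/-- The closed graph theorem gives only some bound depending on `x`. The bound `1` comes from `L_x
(w * s) = (L_x w) * s` with `‖w‖₁ ≤ 1` and `w * s` close to `s`. -/
theorem norm_translate_le (h : IsSegalAlgebra ι) (x : G) (s : S) :
    ‖h.translate x s‖ ≤ ‖s‖ := by
  refine le_of_forall_pos_le_add fun ε hε => ?_
  obtain ⟨w, hw, hws⟩ := h.exists_leftAct_near s (ε := ε / (‖h.translate x‖ + 1)) (by positivity)
  have h1 : ‖h.translate x (h.leftAct w s)‖ ≤ ‖s‖ := by
    rw [translate_leftAct]
    refine (h.norm_leftAct_le _ _).trans (mul_le_of_le_one_left (norm_nonneg s) ?_)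
    rwa [norm_leftTranslate]
  have h2 : ‖h.translate x (h.leftAct w s - s)‖ ≤ ε :=
    calc _ ≤ ‖h.translate x‖ * ‖h.leftAct w s - s‖ := (h.translate x).le_opNorm _
      _ ≤ (‖h.translate x‖ + 1) * (ε / (‖h.translate x‖ + 1)) := by gcongr; linarith
      _ = ε := mul_div_cancel₀ _ (by positivity)
  rw [map_sub] at h2
  have h3 := norm_le_insert (h.translate x (h.leftAct w s)) (h.translate x s)
  linarith

/-- The orbit map is a uniform limit of the maps `x ↦ (L_x w) * s`, whose continuity is that of
translation in `L¹(G)`. -/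
theorem continuous_translate (h : IsSegalAlgebra ι) (s : S) :
    Continuous fun x => h.translate x s := by
  refine continuous_of_uniform_approx_of_continuous fun u hu => ?_
  obtain ⟨ε, hε, hεu⟩ := Metric.mem_uniformity_dist.1 hu
  obtain ⟨w, -, hw⟩ := h.exists_leftAct_near s hε
  refine ⟨fun x => h.translate x (h.leftAct w s), ?_, fun x => hεu ?_⟩
  · simp only [translate_leftAct]
    exact (h.leftAct.flip s).continuous.comp (continuous_leftTranslate w)
  · rw [dist_comm, dist_eq_norm, ← map_sub]
    exact (h.norm_translate_le x _).trans_lt hw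

theorem integrable_smul_translate (h : IsSegalAlgebra ι) (f : LOne μ) (s : S) :
    Integrable (fun y => f y • h.translate y s) μ := by
  refine Integrable.mono' ((L1.integrable_coeFn f).norm.mul_const ‖s‖)
    (aestronglyMeasurable_smul_continuous (L1.integrable_coeFn f) (h.continuous_translate s)) ?_
  filter_upwards with y
  rw [norm_smul]
  exact mul_le_mul_of_nonneg_left (h.norm_translate_le y s) (norm_nonneg _)

theorem leftAct_eq_integral (h : IsSegalAlgebra ι) (f : LOne μ) (s : S) :
    h.leftAct f s = ∫ y, f y • h.translate y s ∂μ := by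
  refine h.injective ?_
  rw [leftAct_spec, conv_apply, ← ι.integral_comp_comm (h.integrable_smul_translate f s)]
  simp only [map_smul, translate_spec]

theorem map_leftAct {X : Type*} [NormedAddCommGroup X] [NormedSpace ℂ X] [CompleteSpace X]
    (h : IsSegalAlgebra ι) (T : S →L[ℂ] X) (f : LOne μ) (s : S) :
    T (h.leftAct f s) = ∫ y, f y • T (h.translate y s) ∂μ := by
  rw [leftAct_eq_integral, ← T.integral_comp_comm (h.integrable_smul_translate f s)]
  simp only [map_smul]

end IsSegalAlgebra

end SegalModule
-- Haar integration on a compact group and orbit tensors.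
section CompactGroup

variable {G : Type*} [Group G] [TopologicalSpace G] [IsTopologicalGroup G]
  [MeasurableSpace G] [BorelSpace G] [CompactSpace G]
  {μ : Measure G} [μ.IsHaarMeasure]

theorem eq_self_of_isMulLeftInvariant_of_compactSpace (ν : Measure G) [ν.IsMulLeftInvariant]
    [IsFiniteMeasureOnCompacts ν] (h1 : ν Set.univ = μ Set.univ) : ν = μ := by
  have h := Measure.isMulInvariant_eq_smul_of_compactSpace ν μ
  rw [h] at h1 ⊢
  set c := Measure.haarScalarFactor ν μ
  have h2 : (c : ℝ≥0∞) = 1 := by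
    rw [Measure.smul_apply] at h1
    change (c : ℝ≥0∞) * μ Set.univ = μ Set.univ at h1
    have h0 : μ Set.univ ≠ 0 := Measure.measure_univ_ne_zero.2 (NeZero.ne μ)
    have ht : μ Set.univ ≠ ∞ := measure_ne_top μ _
    rwa [ENNReal.mul_eq_right h0 ht] at h1
  have h3 : c = 1 := by exact_mod_cast h2
  rw [h3, one_smul]

theorem IsMulRightInvariant.of_compactSpace : μ.IsMulRightInvariant := by
  refine ⟨fun g => eq_self_of_isMulLeftInvariant_of_compactSpace _ ?_⟩
  rw [Measure.map_apply (measurable_mul_const g) MeasurableSet.univ, Set.preimage_univ]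

theorem IsInvInvariant.of_compactSpace : μ.IsInvInvariant := by
  have : μ.IsMulRightInvariant := IsMulRightInvariant.of_compactSpace
  have : IsFiniteMeasureOnCompacts μ.inv := ⟨fun K hK => by
    rw [Measure.inv_apply]
    exact hK.inv.measure_lt_top⟩
  refine ⟨eq_self_of_isMulLeftInvariant_of_compactSpace _ ?_⟩
  rw [Measure.inv_apply, Set.inv_univ]

variable {X Y E F : Type*} [NormedAddCommGroup X] [NormedSpace ℂ X] [CompleteSpace X]
  [NormedAddCommGroup Y] [NormedSpace ℂ Y] [CompleteSpace Y]
  [NormedAddCommGroup E] [NormedSpace ℂ E] [NormedAddCommGroup F] [NormedSpace ℂ F]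

theorem Continuous.integrable_of_compactGroup {φ : G → X} (hφ : Continuous φ) :
    Integrable φ μ :=
  hφ.integrable_of_hasCompactSupport (HasCompactSupport.of_compactSpace φ)

variable (μ X) in
/-- Integration of continuous functions over a compact group. -/
noncomputable def integralC : C(G, X) →L[ℂ] X :=
  LinearMap.mkContinuous
    { toFun := fun φ => ∫ x, φ x ∂μ
      map_add' := fun φ ψ => integral_add φ.continuous.integrable_of_compactGroup
        ψ.continuous.integrable_of_compactGroup
      map_smul' := fun c φ => integral_smul c _ }
    (μ.real Set.univ) fun φ => by
      rw [mul_comm]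
      exact norm_integral_le_of_norm_le_const (Eventually.of_forall φ.norm_coe_le_norm)

@[simp] theorem integralC_apply (φ : C(G, X)) : integralC μ X φ = ∫ x, φ x ∂μ := rfl

theorem integrable_smul_of_continuous (f : LOne μ) {φ : G → X} (hφ : Continuous φ) :
    Integrable (fun y => f y • φ y) μ := by
  obtain ⟨C, hC⟩ := (isCompact_range hφ).isBounded.exists_norm_le
  refine Integrable.mono' ((L1.integrable_coeFn f).norm.mul_const C)
    (aestronglyMeasurable_smul_continuous (L1.integrable_coeFn f) hφ) ?_
  filter_upwards with y
  rw [norm_smul]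
  exact mul_le_mul_of_nonneg_left (hC _ ⟨y, rfl⟩) (norm_nonneg _)

/-- Read `Θ` as a continuous map from `G` to `C(G, X)` and move the bounded operator `∫ dz` inside
the integral over `y`. No product measure enters, so no countability assumption on `G` is needed. -/
theorem integral_swap_smul (f : LOne μ) {Θ : G → G → X}
    (hΘ : Continuous fun p : G × G => Θ p.1 p.2) :
    ∫ z, ∫ y, f y • Θ y z ∂μ ∂μ = ∫ y, f y • ∫ z, Θ y z ∂μ ∂μ := by
  let Ψ : C(G, C(G, X)) := ContinuousMap.curry ⟨fun p : G × G => Θ p.1 p.2, hΘ⟩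
  have hint := integrable_smul_of_continuous f Ψ.continuous
  have h1 := (integralC μ X).integral_comp_comm hint
  have h2 : ∀ z, (∫ y, f y • Ψ y ∂μ) z = ∫ y, f y • Θ y z ∂μ := fun z =>
    ((ContinuousMap.evalCLM ℂ z).integral_comp_comm hint).symm
  simp only [map_smul, integralC_apply, h2] at h1
  exact h1.symm

variable (μ) in
/-- The normalised integral `∫ φ(z⁻¹) ⊗ ψ(z) dz` in `E ⊗̂ F`. -/
noncomputable def orbitTensor (φ : G → E) (ψ : G → F) : ProjTensor E F :=
  (μ.real Set.univ : ℂ)⁻¹ • ∫ z, ProjTensor.tmul (φ z⁻¹) (ψ z) ∂μ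

theorem continuous_tmul {φ : G → E} {ψ : G → F} (hφ : Continuous φ) (hψ : Continuous ψ) :
    Continuous fun z => ProjTensor.tmul (φ z) (ψ z) := by
  exact (ProjTensor.tmulL.continuous.comp hφ).clm_apply hψ

theorem clm_orbitTensor (T : ProjTensor E F →L[ℂ] X) {φ : G → E} {ψ : G → F}
    (hφ : Continuous φ) (hψ : Continuous ψ) :
    T (orbitTensor μ φ ψ)
      = (μ.real Set.univ : ℂ)⁻¹ • ∫ z, T (ProjTensor.tmul (φ z⁻¹) (ψ z)) ∂μ := by
  have h := T.integral_comp_comm (μ := μ)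
    (continuous_tmul (hφ.comp continuous_inv) hψ).integrable_of_compactGroup
  rw [orbitTensor, map_smul]
  exact congrArg _ h.symm

theorem norm_orbitTensor_le {φ : G → E} {ψ : G → F} {a b : ℝ} (hφ : ∀ x, ‖φ x‖ ≤ a)
    (hψ : ∀ x, ‖ψ x‖ ≤ b) : ‖orbitTensor μ φ ψ‖ ≤ a * b := by
  have hpos : 0 < μ.real (Set.univ : Set G) := measureReal_univ_pos
  have ha : 0 ≤ a := (norm_nonneg _).trans (hφ 1)
  have h1 : ‖∫ z, ProjTensor.tmul (φ z⁻¹) (ψ z) ∂μ‖ ≤ a * b * μ.real Set.univ :=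
    norm_integral_le_of_norm_le_const (Eventually.of_forall fun z =>
      (ProjTensor.norm_tmul_le' _ _).trans (mul_le_mul (hφ _) (hψ _) (norm_nonneg _) ha))
  rw [orbitTensor]
  refine (norm_smul_le _ _).trans ?_
  rw [norm_inv, Complex.norm_real, Real.norm_of_nonneg hpos.le]
  exact (mul_le_mul_of_nonneg_left h1 (inv_nonneg.2 hpos.le)).trans_eq (by field_simp)

theorem map_orbitTensor_right {F' : Type*} [NormedAddCommGroup F'] [NormedSpace ℂ F']
    (U : F →L[ℂ] F') {φ : G → E} {ψ : G → F} (hφ : Continuous φ) (hψ : Continuous ψ) :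
    ProjTensor.map (ContinuousLinearMap.id ℂ E) U (orbitTensor μ φ ψ)
      = orbitTensor μ φ fun z => U (ψ z) := by
  rw [clm_orbitTensor _ hφ hψ, orbitTensor]
  simp

theorem lift_orbitTensor (B : E →L[ℂ] F →L[ℂ] X) {φ : G → E} {ψ : G → F} (hφ : Continuous φ)
    (hψ : Continuous ψ) {a : X} (h : ∀ z, B (φ z⁻¹) (ψ z) = a) :
    ProjTensor.lift B (orbitTensor μ φ ψ) = a := by
  have hpos : 0 < μ.real (Set.univ : Set G) := measureReal_univ_pos
  rw [clm_orbitTensor _ hφ hψ]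
  simp only [ProjTensor.lift_tmul, h, integral_const]
  rw [← Complex.coe_smul, smul_smul, inv_mul_cancel₀ (by exact_mod_cast hpos.ne'), one_smul]

/-- For orbit maps `φ`, `ψ` of left translation, `T` is the action of `f`. The substitution `z ↦ z
y` turns `φ (y z⁻¹) ⊗ ψ z` into `φ (z⁻¹) ⊗ ψ (z y)`, transferring the action to the second factor;
hence the inverse in `orbitTensor`. -/
theorem map_orbitTensor_left (f : LOne μ) (T : E →L[ℂ] E) {φ : G → E} {ψ ψ' : G → F}
    [CompleteSpace E] [CompleteSpace F]
    (hφ : Continuous φ) (hψ : Continuous ψ) (hT : ∀ x, T (φ x) = ∫ y, f y • φ (y * x) ∂μ)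
    (hψ' : ∀ z, ψ' z = ∫ y, f y • ψ (z * y) ∂μ) :
    ProjTensor.map T (ContinuousLinearMap.id ℂ F) (orbitTensor μ φ ψ) = orbitTensor μ φ ψ' := by
  have : μ.IsMulRightInvariant := IsMulRightInvariant.of_compactSpace
  rw [clm_orbitTensor _ hφ hψ, orbitTensor]
  congr 1
  have h1 : ∀ z, ProjTensor.map T (ContinuousLinearMap.id ℂ F) (ProjTensor.tmul (φ z⁻¹) (ψ z))
      = ∫ y, f y • ProjTensor.tmul (φ (y * z⁻¹)) (ψ z) ∂μ := fun z => by
    rw [ProjTensor.map_tmul, hT]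
    have := (ProjTensor.tmulL.flip (ψ z)).integral_comp_comm
      (integrable_smul_of_continuous f (hφ.comp (continuous_mul_const z⁻¹)))
    simpa using this.symm
  have h2 : ∀ z, ProjTensor.tmul (φ z⁻¹) (ψ' z)
      = ∫ y, f y • ProjTensor.tmul (φ z⁻¹) (ψ (z * y)) ∂μ := fun z => by
    rw [hψ']
    have := (ProjTensor.tmulL (φ z⁻¹)).integral_comp_comm
      (integrable_smul_of_continuous f (hψ.comp (continuous_const_mul z)))
    simpa using this.symm
  simp only [h1, h2]
  have c1 : Continuous fun p : G × G => ProjTensor.tmul (φ (p.1 * p.2⁻¹)) (ψ p.2) :=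
    (ProjTensor.tmulL.continuous.comp (hφ.comp (by fun_prop))).clm_apply (hψ.comp continuous_snd)
  have c2 : Continuous fun p : G × G => ProjTensor.tmul (φ p.2⁻¹) (ψ (p.2 * p.1)) :=
    (ProjTensor.tmulL.continuous.comp (hφ.comp (by fun_prop))).clm_apply (hψ.comp (by fun_prop))
  rw [integral_swap_smul f c1, integral_swap_smul f c2]
  refine integral_congr_ae (Eventually.of_forall fun y => ?_)
  have h3 := integral_mul_right_eq_self (μ := μ)
    (fun z => ProjTensor.tmul (φ (y * z⁻¹)) (ψ z)) y
  simp only [mul_inv_rev, mul_inv_cancel_left] at h3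
  simp only [h3]

end CompactGroup
-- Class functions and central bumps.
section ClassFunctions

variable {G : Type*} [Group G] [TopologicalSpace G] [IsTopologicalGroup G]
  [MeasurableSpace G] [BorelSpace G] [CompactSpace G]
  {μ : Measure G} [μ.IsHaarMeasure]

variable (μ) in
/-- The inclusion of the continuous functions on a compact group into `L¹(G)`. -/
noncomputable abbrev toLOne : C(G, ℂ) →L[ℂ] LOne μ := ContinuousMap.toLp 1 μ ℂ

theorem toLOne_ae_eq (w : C(G, ℂ)) : toLOne μ w =ᵐ[μ] w := ContinuousMap.coeFn_toLp μ w

theorem augmentation_toLOne (w : C(G, ℂ)) : augmentation μ (toLOne μ w) = ∫ x, w x ∂μ := by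
  rw [augmentation_apply, integral_congr_ae (toLOne_ae_eq w)]

theorem norm_toLOne (w : C(G, ℂ)) : ‖toLOne μ w‖ = ∫ x, ‖w x‖ ∂μ := by
  rw [L1.norm_eq_integral_norm]
  refine integral_congr_ae ?_
  filter_upwards [toLOne_ae_eq (μ := μ) w] with x hx
  rw [hx]

/-- The map `y ↦ L_y w` from a compact group to the continuous functions. -/
noncomputable def leftOrbit (w : C(G, ℂ)) : C(G, C(G, ℂ)) :=
  ContinuousMap.curry ⟨fun p : G × G => w (p.1⁻¹ * p.2), by fun_prop⟩

@[simp] theorem leftOrbit_apply (w : C(G, ℂ)) (y x : G) : leftOrbit w y x = w (y⁻¹ * x) := rfl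

theorem toLOne_leftOrbit (w : C(G, ℂ)) (y : G) :
    toLOne μ (leftOrbit w y) = leftTranslate y (toLOne μ w) := by
  refine Lp.ext ?_
  have h : ∀ᵐ x ∂μ, toLOne μ w (y⁻¹ * x) = w (y⁻¹ * x) :=
    (measurePreserving_mul_left μ y⁻¹).quasiMeasurePreserving.ae (toLOne_ae_eq w)
  filter_upwards [toLOne_ae_eq (μ := μ) (leftOrbit w y), leftTranslate_ae_eq y (toLOne μ w), h]
    with x h1 h2 h3
  rw [h1, h2, h3, leftOrbit_apply]

/-- The continuous representative of `f * w` for `f ∈ L¹(G)` and `w` continuous. -/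
noncomputable def convC (f : LOne μ) (w : C(G, ℂ)) : C(G, ℂ) := ∫ y, f y • leftOrbit w y ∂μ

theorem map_convC {X : Type*} [NormedAddCommGroup X] [NormedSpace ℂ X] [CompleteSpace X]
    (T : C(G, ℂ) →L[ℂ] X) (f : LOne μ) (w : C(G, ℂ)) :
    T (convC f w) = ∫ y, f y • T (leftOrbit w y) ∂μ := by
  rw [convC, ← T.integral_comp_comm (integrable_smul_of_continuous f (leftOrbit w).continuous)]
  simp

theorem convC_apply (f : LOne μ) (w : C(G, ℂ)) (x : G) :
    convC f w x = ∫ y, f y * w (y⁻¹ * x) ∂μ :=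
  map_convC (ContinuousMap.evalCLM ℂ x) f w

theorem toLOne_convC (f : LOne μ) (w : C(G, ℂ)) :
    toLOne μ (convC f w) = conv f (toLOne μ w) := by
  rw [map_convC, conv_apply]
  simp only [toLOne_leftOrbit]
  rfl

theorem convC_toLOne_apply (f w : C(G, ℂ)) (x : G) :
    convC (toLOne μ f) w x = ∫ y, f y * w (y⁻¹ * x) ∂μ := by
  rw [convC_apply]
  refine integral_congr_ae ?_
  filter_upwards [toLOne_ae_eq (μ := μ) f] with y hy
  rw [hy]

/-- A continuous function on a group that is constant on conjugacy classes. -/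
def IsClassFunction (w : C(G, ℂ)) : Prop := ∀ x y, w (x * y) = w (y * x)

/-- Substitute `y ↦ x y⁻¹` and use `w (x y⁻¹) = w (y⁻¹ x)`. -/
theorem IsClassFunction.convC_comm {w : C(G, ℂ)} (hw : IsClassFunction w) (f : C(G, ℂ)) :
    convC (toLOne μ w) f = convC (toLOne μ f) w := by
  have : μ.IsInvInvariant := IsInvInvariant.of_compactSpace
  ext x
  rw [convC_toLOne_apply, convC_toLOne_apply,
    ← integral_div_left_eq_self (fun y => w y * f (y⁻¹ * x)) μ x]
  refine integral_congr_ae (Eventually.of_forall fun y => ?_)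
  simp only [div_eq_mul_inv, mul_inv_rev, inv_inv, inv_mul_cancel_right]
  rw [hw x y⁻¹, mul_comm]

/-- An element of the center of `L¹(G)`. -/
def IsCentralElement (u : LOne μ) : Prop := ∀ f, conv u f = conv f u

variable [T2Space G]

theorem IsClassFunction.isCentralElement {w : C(G, ℂ)} (hw : IsClassFunction w) :
    IsCentralElement (toLOne μ w) := by
  intro f
  refine (ContinuousMap.toLp_denseRange ℂ μ ℂ ENNReal.one_ne_top).induction_on
    (p := fun f : LOne μ => conv (toLOne μ w) f = conv f (toLOne μ w)) f
    (isClosed_eq (conv (toLOne μ w)).continuous ((conv (μ := μ)).flip (toLOne μ w)).continuous)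
    fun v => ?_
  rw [← toLOne_convC, ← toLOne_convC, hw.convC_comm]

/-- For each `y` the condition holds near `(1, y)`; compactness of `G` makes the neighbourhood of
`1` uniform in `y`. -/
theorem exists_conj_invariant_nhds {V : Set G} (hV : V ∈ 𝓝 (1 : G)) :
    ∃ U : Set G, IsOpen U ∧ 1 ∈ U ∧ ∀ u ∈ U, ∀ y : G, y * u * y⁻¹ ∈ V := by
  have h : ∀ᶠ u in 𝓝 (1 : G), ∀ y ∈ (Set.univ : Set G), y * u * y⁻¹ ∈ V := by
    refine isCompact_univ.eventually_forall_of_forall_eventually fun y _ => ?_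
    have hc : Continuous fun p : G × G => p.2 * p.1 * p.2⁻¹ := by fun_prop
    have h1 := hc.tendsto (1, y)
    simp only [mul_one, mul_inv_cancel] at h1
    exact h1 hV
  obtain ⟨U, hU, hUo, hU1⟩ := mem_nhds_iff.1 h
  exact ⟨U, hUo, hU1, fun u hu y => hU hu y (Set.mem_univ y)⟩

theorem exists_symmetric_bump {V : Set G} (hV : V ∈ 𝓝 (1 : G)) :
    ∃ k : C(G, ℝ), k 1 = 1 ∧ (∀ x, 0 ≤ k x) ∧ (∀ x, k x⁻¹ = k x) ∧
      ∀ x y, k (y * x * y⁻¹) ≠ 0 → x ∈ V := by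
  obtain ⟨U, hUo, hU1, hU⟩ := exists_conj_invariant_nhds hV
  obtain ⟨g, hg0, hg1, hg⟩ := exists_continuous_zero_one_of_isClosed hUo.isClosed_compl
    (isClosed_singleton (x := (1 : G))) (Set.disjoint_singleton_right.2 fun h => h hU1)
  have hg1' : g 1 = 1 := hg1 rfl
  refine ⟨g * g.comp ⟨fun x => x⁻¹, continuous_inv⟩, ?_, fun x => ?_, fun x => ?_,
    fun x y hxy => ?_⟩
  · simp [hg1']
  · exact mul_nonneg (hg x).1 (hg x⁻¹).1
  · simp [mul_comm]
  · have h1 : y * x * y⁻¹ ∈ U := by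
      by_contra h
      have h2 : g (y * x * y⁻¹) = 0 := hg0 h
      simp [h2] at hxy
    have h2 := hU _ h1 y⁻¹
    have h3 : y⁻¹ * (y * x * y⁻¹) * y⁻¹⁻¹ = x := by group
    rwa [h3] at h2

/-- Central bump functions on a compact group that are real and symmetric. -/
theorem exists_isClassFunction_isBump {V : Set G} (hV : V ∈ 𝓝 (1 : G)) :
    ∃ w : C(G, ℂ), IsClassFunction w ∧ (∀ x, starRingEnd ℂ (w x⁻¹) = w x) ∧
      IsBump V (toLOne μ w) := by
  have : μ.IsMulRightInvariant := IsMulRightInvariant.of_compactSpace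
  obtain ⟨k, hk1, hk0, hks, hkV⟩ := exists_symmetric_bump hV
  -- Averaging `k` over conjugation gives a class function. Integrating in `C(G, ℝ)` keeps it
  -- continuous, and the support condition on conjugates of `k` keeps it supported in `V`.
  let Ψ : C(G, C(G, ℝ)) :=
    ContinuousMap.curry ⟨fun p : G × G => k (p.1 * p.2 * p.1⁻¹), by fun_prop⟩
  let r : C(G, ℝ) := ∫ y, Ψ y ∂μ
  have hr : ∀ x, r x = ∫ y, k (y * x * y⁻¹) ∂μ := fun x =>
    ((ContinuousMap.evalCLM ℝ x).integral_comp_comm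
      (Ψ.continuous.integrable_of_hasCompactSupport (HasCompactSupport.of_compactSpace _))).symm
  have hr0 : ∀ x, 0 ≤ r x := fun x => by
    rw [hr]
    exact integral_nonneg fun y => hk0 _
  have hr1 : r 1 ≠ 0 := by
    have h0 : 0 < μ.real (Set.univ : Set G) := measureReal_univ_pos
    rw [hr]
    simp [hk1, h0.ne']
  have hrc : ∀ x y, r (x * y) = r (y * x) := fun x y => by
    rw [hr, hr, ← integral_mul_right_eq_self (fun z => k (z * (y * x) * z⁻¹)) x]
    refine integral_congr_ae (Eventually.of_forall fun z => ?_)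
    simp only [mul_inv_rev]
    congr 1
    group
  have hrs : ∀ x, r x⁻¹ = r x := fun x => by
    rw [hr, hr]
    refine integral_congr_ae (Eventually.of_forall fun z => ?_)
    have : z * x⁻¹ * z⁻¹ = (z * x * z⁻¹)⁻¹ := by group
    simp only [this, hks]
  have hrV : ∀ x, x ∉ V → r x = 0 := fun x hx => by
    rw [hr]
    refine integral_eq_zero_of_ae (Eventually.of_forall fun y => ?_)
    by_contra h
    exact hx (hkV x y h)
  set I := ∫ x, r x ∂μ with hI
  have hIpos : 0 < I := r.continuous.integral_pos_of_hasCompactSupport_nonneg_nonzero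
    (HasCompactSupport.of_compactSpace _) hr0 hr1
  let w : C(G, ℂ) := ⟨fun x => ((I⁻¹ * r x : ℝ) : ℂ), by fun_prop⟩
  have hw : ∀ x, w x = ((I⁻¹ * r x : ℝ) : ℂ) := fun x => rfl
  have hint : ∫ x, I⁻¹ * r x ∂μ = 1 := by
    rw [integral_const_mul, ← hI, inv_mul_cancel₀ hIpos.ne']
  refine ⟨w, fun x y => ?_, fun x => ?_, ?_, ?_, ?_⟩
  · rw [hw, hw, hrc]
  · rw [hw, hw, Complex.conj_ofReal, hrs]
  · filter_upwards [toLOne_ae_eq (μ := μ) w] with x hx hxV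
    rw [hx, hw, hrV x hxV]
    simp
  · rw [augmentation_toLOne]
    simp only [hw]
    exact (integral_complex_ofReal (f := fun x => I⁻¹ * r x)).trans (by rw [hint, Complex.ofReal_one])
  · rw [norm_toLOne]
    have h1 : ∀ x, ‖w x‖ = I⁻¹ * r x := fun x => by
      rw [hw, Complex.norm_real, Real.norm_of_nonneg (mul_nonneg (inv_nonneg.2 hIpos.le) (hr0 x))]
    simp only [h1, hint, le_refl]

end ClassFunctions
-- Spectral theory of convolution operators and central elements of `S`.
section Spectral

variable {G : Type*} [Group G] [TopologicalSpace G] [IsTopologicalGroup G]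
  [MeasurableSpace G] [BorelSpace G] [CompactSpace G]
  {μ : Measure G} [μ.IsHaarMeasure]

theorem norm_leftOrbit_le (w : C(G, ℂ)) (y : G) : ‖leftOrbit w y‖ ≤ ‖w‖ :=
  (ContinuousMap.norm_le _ (norm_nonneg w)).2 fun _ => w.norm_coe_le_norm _

/-- Convolution with a continuous function as a bounded operator from `L¹(G)` to `C(G)`. -/
noncomputable def convCL (w : C(G, ℂ)) : LOne μ →L[ℂ] C(G, ℂ) :=
  LinearMap.mkContinuous
    { toFun := fun f => convC f w
      map_add' := fun f g => by
        ext x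
        rw [ContinuousMap.add_apply]
        have hf := integrable_smul_of_continuous f
          (w.continuous.comp (continuous_inv.mul (continuous_const (y := x))))
        have hg := integrable_smul_of_continuous g
          (w.continuous.comp (continuous_inv.mul (continuous_const (y := x))))
        rw [convC_apply, convC_apply, convC_apply]
        refine Eq.trans ?_ (integral_add hf hg)
        refine integral_congr_ae ?_
        filter_upwards [Lp.coeFn_add f g] with y hy
        rw [hy, Pi.add_apply, add_mul]
      map_smul' := fun c f => by
        ext x
        rw [ContinuousMap.smul_apply, convC_apply, RingHom.id_apply, convC_apply, ← integral_smul]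
        refine integral_congr_ae ?_
        filter_upwards [Lp.coeFn_smul c f] with y hy
        rw [hy, Pi.smul_apply, smul_mul_assoc] }
    ‖w‖ fun f => by
      change ‖∫ y, f y • leftOrbit w y ∂μ‖ ≤ _
      rw [L1.norm_eq_integral_norm, mul_comm, ← integral_mul_const]
      refine norm_integral_le_of_norm_le ((L1.integrable_coeFn f).norm.mul_const _)
        (Eventually.of_forall fun y => ?_)
      rw [norm_smul]
      exact mul_le_mul_of_nonneg_left (norm_leftOrbit_le w y) (norm_nonneg _)

variable (μ) in
/-- The inclusion of the continuous functions on a compact group into `L²(G)`. -/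
noncomputable abbrev toLTwo : C(G, ℂ) →L[ℂ] Lp ℂ 2 μ := ContinuousMap.toLp 2 μ ℂ

theorem toLTwo_ae_eq (w : C(G, ℂ)) : toLTwo μ w =ᵐ[μ] w := ContinuousMap.coeFn_toLp μ w

theorem memLp_one_of_lTwo (g : Lp ℂ 2 μ) : MemLp (fun x => g x) 1 μ :=
  (Lp.memLp g).mono_exponent one_le_two

/-- The inclusion of `L²(G)` into `L¹(G)` for a compact group. -/
noncomputable def lTwoInclusion : Lp ℂ 2 μ →L[ℂ] LOne μ :=
  LinearMap.mkContinuous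
    { toFun := fun g => (memLp_one_of_lTwo g).toLp
      map_add' := fun f g => by
        rw [← MemLp.toLp_add]
        exact MemLp.toLp_congr _ _ (Lp.coeFn_add f g)
      map_smul' := fun c f => by
        rw [RingHom.id_apply, ← MemLp.toLp_const_smul]
        exact MemLp.toLp_congr _ _ (Lp.coeFn_smul c f) }
    ((μ Set.univ) ^ (1 / (1 : ℝ≥0∞).toReal - 1 / (2 : ℝ≥0∞).toReal)).toReal fun g => by
      change ‖(memLp_one_of_lTwo g).toLp‖ ≤ _
      rw [Lp.norm_toLp, Lp.norm_def, ← ENNReal.toReal_mul, mul_comm]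
      refine ENNReal.toReal_mono ?_ (eLpNorm_le_eLpNorm_mul_rpow_measure_univ one_le_two
        (Lp.aestronglyMeasurable g))
      refine ENNReal.mul_ne_top (Lp.eLpNorm_ne_top g) ?_
      exact ENNReal.rpow_ne_top_of_nonneg (by norm_num) (measure_ne_top μ _)

theorem lTwoInclusion_ae_eq (g : Lp ℂ 2 μ) : lTwoInclusion g =ᵐ[μ] g :=
  MemLp.coeFn_toLp (memLp_one_of_lTwo g)

theorem lTwoInclusion_toLTwo (w : C(G, ℂ)) : lTwoInclusion (toLTwo μ w) = toLOne μ w := by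
  refine Lp.ext ?_
  filter_upwards [lTwoInclusion_ae_eq (toLTwo μ w), toLTwo_ae_eq (μ := μ) w,
    toLOne_ae_eq (μ := μ) w] with x h1 h2 h3
  rw [h1, h2, h3]

theorem convC_lTwoInclusion_apply (g : Lp ℂ 2 μ) (w : C(G, ℂ)) (x : G) :
    convC (lTwoInclusion g) w x = ∫ y, g y * w (y⁻¹ * x) ∂μ := by
  rw [convC_apply]
  refine integral_congr_ae ?_
  filter_upwards [lTwoInclusion_ae_eq g] with y hy
  rw [hy]

/-- Convolution on the right by a continuous function as an operator on `L²(G)`. -/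
noncomputable def convOp (w : C(G, ℂ)) : Lp ℂ 2 μ →L[ℂ] Lp ℂ 2 μ :=
  (toLTwo μ).comp ((convCL w).comp lTwoInclusion)

theorem convOp_apply (w : C(G, ℂ)) (g : Lp ℂ 2 μ) :
    convOp w g = toLTwo μ (convC (lTwoInclusion g) w) := rfl

theorem lTwoInclusion_convOp (w : C(G, ℂ)) (g : Lp ℂ 2 μ) :
    lTwoInclusion (convOp w g) = conv (lTwoInclusion g) (toLOne μ w) := by
  rw [convOp_apply, lTwoInclusion_toLTwo, toLOne_convC]

theorem norm_convC_sub_le (f : LOne μ) (w : C(G, ℂ)) (x x' : G) {ε : ℝ}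
    (h : ∀ y, ‖w (y⁻¹ * x) - w (y⁻¹ * x')‖ ≤ ε) :
    ‖convC f w x - convC f w x'‖ ≤ ‖f‖ * ε := by
  have hi : ∀ x, Integrable (fun y => f y * w (y⁻¹ * x)) μ := fun x =>
    integrable_smul_of_continuous f
      (w.continuous.comp (continuous_inv.mul (continuous_const (y := x))))
  rw [convC_apply, convC_apply, ← integral_sub (hi x) (hi x'), L1.norm_eq_integral_norm,
    ← integral_mul_const]
  refine norm_integral_le_of_norm_le ((L1.integrable_coeFn f).norm.mul_const _)
    (Eventually.of_forall fun y => ?_)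
  rw [← mul_sub, norm_mul]
  exact mul_le_mul_of_nonneg_left (h y) (norm_nonneg _)

/-- Uniform continuity of `w` makes the functions `g * w`, for `g` in the unit ball of `L²(G)`,
equicontinuous; Arzelà–Ascoli applies in `C(G)`, which maps continuously to `L²(G)`. -/
theorem isCompactOperator_convOp (w : C(G, ℂ)) :
    IsCompactOperator (convOp w : Lp ℂ 2 μ →L[ℂ] Lp ℂ 2 μ) := by
  set R := ‖(lTwoInclusion : Lp ℂ 2 μ →L[ℂ] LOne μ)‖ with hR
  have hball : ∀ g ∈ Metric.closedBall (0 : Lp ℂ 2 μ) 1, ‖lTwoInclusion g‖ ≤ R := fun g hg => by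
    refine (lTwoInclusion.le_opNorm g).trans (mul_le_of_le_one_right (norm_nonneg _) ?_)
    simpa using hg
  let e := ContinuousMap.linearIsometryBoundedOfCompact G ℂ ℂ
  set A := (fun g : Lp ℂ 2 μ => e (convC (lTwoInclusion g) w)) '' Metric.closedBall 0 1 with hA
  have hAc : IsCompact (closure A) := by
    refine BoundedContinuousFunction.arzela_ascoli
      (Metric.closedBall (0 : ℂ) (‖(convCL w : LOne μ →L[ℂ] C(G, ℂ))‖ * R))
      (isCompact_closedBall _ _) A ?_ ?_
    · rintro _ x ⟨g, hg, rfl⟩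
      rw [mem_closedBall_zero_iff]
      refine (ContinuousMap.norm_coe_le_norm (convC (lTwoInclusion g) w) x).trans ?_
      exact ((convCL w).le_opNorm (lTwoInclusion g)).trans
        (mul_le_mul_of_nonneg_left (hball g hg) (norm_nonneg _))
    · intro x
      let χ : C(G, C(G, ℂ)) :=
        ContinuousMap.curry ⟨fun p : G × G => w (p.2⁻¹ * p.1), by fun_prop⟩
      refine Metric.equicontinuousAt_iff_right.2 fun ε hε => ?_
      have h1 := Metric.tendsto_nhds.1 (χ.continuous.tendsto x) (ε / (R + 1)) (by positivity)
      filter_upwards [h1] with x' hx' ⟨_, g, hg, rfl⟩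
      rw [dist_comm, dist_eq_norm]
      have h2 : ‖convC (lTwoInclusion g) w x' - convC (lTwoInclusion g) w x‖
          ≤ ‖lTwoInclusion g‖ * ‖χ x' - χ x‖ :=
        norm_convC_sub_le _ _ _ _ fun y => (χ x' - χ x).norm_coe_le_norm y
      refine h2.trans_lt ?_
      rw [dist_eq_norm] at hx'
      calc ‖lTwoInclusion g‖ * ‖χ x' - χ x‖ ≤ R * ‖χ x' - χ x‖ := by
            gcongr; exact hball g hg
        _ ≤ (R + 1) * ‖χ x' - χ x‖ := by gcongr; linarith
        _ < (R + 1) * (ε / (R + 1)) := by gcongr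
        _ = ε := mul_div_cancel₀ _ (by positivity)
  refine (isCompactOperator_iff_image_closedBall_subset_compact
    (convOp w : Lp ℂ 2 μ →L[ℂ] Lp ℂ 2 μ).toLinearMap one_pos).2
    ⟨(fun u => toLTwo μ (e.symm u)) '' closure A,
      hAc.image ((toLTwo μ).continuous.comp e.symm.continuous), ?_⟩
  rintro _ ⟨g, hg, rfl⟩
  exact ⟨_, subset_closure ⟨g, hg, rfl⟩, congrArg (toLTwo μ) (e.symm_apply_apply _)⟩

/-- The condition on `w` makes the integral kernel `w (y⁻¹ x)` Hermitian. -/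
theorem isSymmetric_convOp {w : C(G, ℂ)} (hw : ∀ x, starRingEnd ℂ (w x⁻¹) = w x) :
    (convOp w : Lp ℂ 2 μ →L[ℂ] Lp ℂ 2 μ).IsSymmetric := by
  intro f g
  change inner ℂ (convOp w f) g = inner ℂ f (convOp w g)
  have h1 : inner ℂ f (convOp w g)
      = ∫ y, lTwoInclusion g y • inner ℂ f (toLTwo μ (leftOrbit w y)) ∂μ :=
    map_convC ((innerSL ℂ f).comp (toLTwo μ)) (lTwoInclusion g) w
  have h2 : ∀ y, inner ℂ f (toLTwo μ (leftOrbit w y))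
      = starRingEnd ℂ (convC (lTwoInclusion f) w y) := fun y => by
    rw [convC_lTwoInclusion_apply, ← integral_conj, L2.inner_def]
    refine integral_congr_ae ?_
    filter_upwards [toLTwo_ae_eq (μ := μ) (leftOrbit w y)] with x hx
    have h3 : w (y⁻¹ * x) = starRingEnd ℂ (w (x⁻¹ * y)) := by
      rw [← hw (y⁻¹ * x), mul_inv_rev, inv_inv]
    rw [hx, leftOrbit_apply, RCLike.inner_apply, map_mul (starRingEnd ℂ), mul_comm, h3]
  rw [h1, L2.inner_def]
  refine integral_congr_ae ?_
  filter_upwards [toLTwo_ae_eq (μ := μ) (convC (lTwoInclusion f) w), lTwoInclusion_ae_eq g]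
    with y h3 h4
  rw [h2, h4, convOp_apply, h3, RCLike.inner_apply, smul_eq_mul]

variable (μ) in
theorem measurePreserving_conj (x : G) : MeasurePreserving (fun z => x⁻¹ * z * x) μ μ := by
  have : μ.IsMulRightInvariant := IsMulRightInvariant.of_compactSpace
  exact (measurePreserving_mul_right μ x).comp (measurePreserving_mul_left μ x⁻¹)

variable (μ) in
/-- The isometry of `L²(G)` induced by conjugation with `x`. -/
noncomputable def conjOp (x : G) : Lp ℂ 2 μ →ₗᵢ[ℂ] Lp ℂ 2 μ :=
  Lp.compMeasurePreservingₗᵢ ℂ (fun z => x⁻¹ * z * x) (measurePreserving_conj μ x)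

theorem conjOp_ae_eq (x : G) (g : Lp ℂ 2 μ) : conjOp μ x g =ᵐ[μ] fun z => g (x⁻¹ * z * x) :=
  Lp.coeFn_compMeasurePreserving g (measurePreserving_conj μ x)

/-- The composition of a continuous function with conjugation by `x`. -/
noncomputable def conjC (x : G) (w : C(G, ℂ)) : C(G, ℂ) := w.comp ⟨fun z => x⁻¹ * z * x, by fun_prop⟩

theorem conjC_apply (x : G) (w : C(G, ℂ)) (z : G) : conjC x w z = w (x⁻¹ * z * x) := rfl

theorem conjOp_toLTwo (x : G) (w : C(G, ℂ)) :
    conjOp μ x (toLTwo μ w) = toLTwo μ (conjC x w) := by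
  refine Lp.ext ?_
  have h := (measurePreserving_conj μ x).quasiMeasurePreserving.ae (toLTwo_ae_eq (μ := μ) w)
  filter_upwards [conjOp_ae_eq x (toLTwo μ w), toLTwo_ae_eq (μ := μ) (conjC x w), h]
    with z h1 h2 h3
  rw [h1, h2, h3, conjC_apply]

theorem IsClassFunction.conjC_eq {w : C(G, ℂ)} (hw : IsClassFunction w) (x : G) :
    conjC x w = w := by
  ext z
  rw [conjC_apply, mul_assoc, hw, mul_inv_cancel_right]

theorem isClassFunction_of_conjC_eq {w : C(G, ℂ)} (hw : ∀ x, conjC x w = w) :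
    IsClassFunction w := fun x y => by
  conv_lhs => rw [← hw y⁻¹]
  rw [conjC_apply, inv_inv, ← mul_assoc, mul_inv_cancel_right]

/-- Consequently conjugation preserves each eigenspace of `convOp w`. -/
theorem IsClassFunction.conjOp_convOp {w : C(G, ℂ)} (hw : IsClassFunction w) (x : G)
    (g : Lp ℂ 2 μ) : conjOp μ x (convOp w g) = convOp w (conjOp μ x g) := by
  rw [convOp_apply, convOp_apply, conjOp_toLTwo]
  congr 1
  ext z
  rw [conjC_apply, convC_lTwoInclusion_apply, convC_lTwoInclusion_apply]
  have : μ.IsMulRightInvariant := IsMulRightInvariant.of_compactSpace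
  set F : G → ℂ := fun y => g y * w (y⁻¹ * (x⁻¹ * z * x)) with hF
  rw [← integral_mul_right_eq_self F x, ← integral_mul_left_eq_self (fun y => F (y * x)) x⁻¹]
  refine integral_congr_ae ?_
  filter_upwards [conjOp_ae_eq x g] with y hy
  rw [hy, hF]
  have h : (x⁻¹ * y * x)⁻¹ * (x⁻¹ * z * x) = x⁻¹ * (y⁻¹ * z * x) := by group
  simp only [h]
  rw [hw x⁻¹, mul_inv_cancel_right]

variable {S : Type*} [NormedAddCommGroup S] [NormedSpace ℂ S] {ι : S →L[ℂ] LOne μ}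

/-- An `L¹` eigenfunction `f = c⁻¹ (f * w)` has a continuous representative, so the eigenspace
embeds into an `L²` eigenspace of a compact operator. -/
theorem finiteDimensional_ker_conv {w : C(G, ℂ)} {c : ℂ} (hc : c ≠ 0) :
    FiniteDimensional ℂ ((conv (μ := μ)).flip (toLOne μ w)
      - c • ContinuousLinearMap.id ℂ (LOne μ)).toLinearMap.ker := by
  set D := ((conv (μ := μ)).flip (toLOne μ w)
    - c • ContinuousLinearMap.id ℂ (LOne μ)).toLinearMap.ker with hD
  have hmem : ∀ f : D, conv f.1 (toLOne μ w) = c • f.1 := fun f => sub_eq_zero.1 f.2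
  have := ContinuousLinearMap.finite_dimensional_eigenspace
    (isCompactOperator_convOp (μ := μ) w) c hc
  have hT : ∀ f : D, (((toLTwo μ).comp (convCL w)).toLinearMap.comp D.subtype) f
      ∈ Module.End.eigenspace (convOp w : Lp ℂ 2 μ →L[ℂ] Lp ℂ 2 μ).toLinearMap c := by
    intro f
    refine Module.End.mem_eigenspace_iff.2 ?_
    change toLTwo μ (convCL w (lTwoInclusion (toLTwo μ (convC f.1 w))))
      = c • toLTwo μ (convCL w f.1)
    rw [lTwoInclusion_toLTwo, toLOne_convC, hmem, map_smul, map_smul]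
  refine FiniteDimensional.of_injective
    ((((toLTwo μ).comp (convCL w)).toLinearMap.comp D.subtype).codRestrict _ hT) ?_
  rw [LinearMap.injective_codRestrict_iff, injective_iff_map_eq_zero]
  intro f hf
  have h1 : lTwoInclusion (toLTwo μ (convC f.1 w)) = 0 := by
    change toLTwo μ (convC f.1 w) = 0 at hf
    rw [hf, map_zero]
  rw [lTwoInclusion_toLTwo, toLOne_convC, hmem] at h1
  exact Subtype.ext ((smul_eq_zero.1 h1).resolve_left hc)

namespace IsSegalAlgebra

/-- For `s ∈ S` the product `f * s` lies in `S` and, `w` being central, in the same eigenspace `D`.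
As `D ∩ S` is finite-dimensional, hence closed, density of `S` gives `f * g ∈ S` for all `g`; then
take `g = w`, where `f * w = c f`. -/
theorem mem_range_of_conv_eq_smul (h : IsSegalAlgebra ι) {w : C(G, ℂ)}
    (hw : IsCentralElement (toLOne μ w)) {c : ℂ} (hc : c ≠ 0) {f : LOne μ}
    (hf : conv f (toLOne μ w) = c • f) : f ∈ ι.toLinearMap.range := by
  have := finiteDimensional_ker_conv (μ := μ) (w := w) hc
  set D := ((conv (μ := μ)).flip (toLOne μ w)
    - c • ContinuousLinearMap.id ℂ (LOne μ)).toLinearMap.ker with hD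
  have hmem : ∀ g : LOne μ, g ∈ D ↔ conv g (toLOne μ w) = c • g := fun g => sub_eq_zero
  have hcl : IsClosed ((D ⊓ ι.toLinearMap.range : Submodule ℂ (LOne μ)) : Set (LOne μ)) :=
    Submodule.closed_of_finiteDimensional _
  have hall : ∀ g, conv f g ∈ D ⊓ ι.toLinearMap.range := fun g => by
    refine h.denseRange.induction_on (p := fun g => conv f g ∈ D ⊓ ι.toLinearMap.range) g
      (hcl.preimage (conv f).continuous) fun s => ⟨?_, h.leftAct f s, h.leftAct_spec f s⟩
    change conv f (ι s) ∈ D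
    rw [hmem, conv_assoc, ← hw, ← conv_assoc, hf, map_smul]
    rfl
  have h1 := (hall (toLOne μ w)).2
  rw [hf] at h1
  exact (Submodule.smul_mem_iff _ hc).1 h1

variable [T2Space G]

theorem exists_central_near (h : IsSegalAlgebra ι) {w : C(G, ℂ)} (hwc : IsClassFunction w)
    (hw : ∀ x, starRingEnd ℂ (w x⁻¹) = w x) {ε : ℝ} (hε : 0 < ε) :
    ∃ s : S, IsCentralElement (ι s) ∧ ‖ι s - conv (toLOne μ w) (toLOne μ w)‖ < ε := by
  set T : Lp ℂ 2 μ →L[ℂ] Lp ℂ 2 μ := convOp w with hT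
  set v := toLTwo μ w with hv
  set j : Lp ℂ 2 μ →L[ℂ] LOne μ := lTwoInclusion with hj
  have hcompact : IsCompactOperator T := isCompactOperator_convOp w
  have hdense : (⨆ c, Module.End.eigenspace T.toLinearMap c).topologicalClosure = ⊤ :=
    Submodule.topologicalClosure_eq_top_iff.2
      (ContinuousLinearMap.orthogonalComplement_iSup_eigenspaces_eq_bot hcompact
        (isSymmetric_convOp hw))
  have hvmem : v ∈ closure ((⨆ c, Module.End.eigenspace T.toLinearMap c :
      Submodule ℂ (Lp ℂ 2 μ)) : Set (Lp ℂ 2 μ)) := by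
    rw [← Submodule.topologicalClosure_coe, hdense]
    trivial
  obtain ⟨g, hg, hvg⟩ := Metric.mem_closure_iff.1 hvmem (ε / (‖j‖ * ‖T‖ + 1)) (by positivity)
  obtain ⟨a, ha, rfl⟩ := (Submodule.mem_iSup_iff_exists_finsupp _ _).1 hg
  classical
  -- The eigenvalue `0` is discarded, since its eigenspace may be infinite-dimensional and outside
  -- `S`. Nothing is lost for `w * w = T v`, because `T` kills that component of `v`.
  let E : ℂ → Submodule ℂ (Lp ℂ 2 μ) := fun c =>
    if c = 0 then ⊥ else Module.End.eigenspace T.toLinearMap c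
  have hEfin : ∀ c, FiniteDimensional ℂ (E c) := fun c => by
    by_cases hc : c = 0
    · have hEc : E c = ⊥ := if_pos hc
      rw [hEc]
      infer_instance
    · have hEc : E c = Module.End.eigenspace T.toLinearMap c := if_neg hc
      rw [hEc]
      exact ContinuousLinearMap.finite_dimensional_eigenspace hcompact c hc
  have hE : ∀ {c g}, g ∈ E c → g = 0 ∨ c ≠ 0 ∧ T g = c • g := fun {c g} hg => by
    by_cases hc : c = 0
    · simp only [E, hc, if_true] at hg
      exact Or.inl hg
    · simp only [E, hc, if_false] at hg
      exact Or.inr ⟨hc, Module.End.mem_eigenspace_iff.1 hg⟩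
  have hE' : ∀ {c g}, c ≠ 0 → T g = c • g → g ∈ E c := fun {c g} hc hg => by
    simp only [E, hc, if_false]
    exact Module.End.mem_eigenspace_iff.2 hg
  set F : Submodule ℂ (Lp ℂ 2 μ) := a.support.sup E with hF
  have hFfin : FiniteDimensional ℂ F := Submodule.finiteDimensional_finset_sup _ _
  have hFrange : F ≤ (toLTwo μ).toLinearMap.range := by
    refine Finset.sup_le fun c _ g hg => ?_
    rcases hE hg with rfl | ⟨hc, hg⟩
    · exact Submodule.zero_mem _
    · refine ⟨c⁻¹ • convC (j g) w, ?_⟩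
      change toLTwo μ (c⁻¹ • convC (j g) w) = g
      rw [map_smul, ← convOp_apply, ← hT, hg, smul_smul, inv_mul_cancel₀ hc, one_smul]
  have hFι : F ≤ ι.toLinearMap.range.comap j.toLinearMap := by
    refine Finset.sup_le fun c _ g hg => ?_
    rcases hE hg with rfl | ⟨hc, hg⟩
    · exact Submodule.zero_mem _
    · refine h.mem_range_of_conv_eq_smul hwc.isCentralElement hc (f := j g) ?_
      rw [hj, ← lTwoInclusion_convOp, ← hT, hg, map_smul]
  have hFconj : ∀ x, F.map (conjOp μ x).toLinearMap = F := fun x => by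
    refine Submodule.eq_of_le_of_finrank_eq (Submodule.map_le_iff_le_comap.2 ?_) ?_
    · refine Finset.sup_le fun c hc' g hg => ?_
      rcases hE hg with rfl | ⟨hc, hg⟩
      · exact Submodule.zero_mem _
      · refine Finset.le_sup (f := E) hc' (hE' hc ?_)
        change T (conjOp μ x g) = c • conjOp μ x g
        rw [hT, ← hwc.conjOp_convOp, ← hT, hg, map_smul]
    · exact (Submodule.equivMapOfInjective _ (conjOp μ x).injective F).finrank_eq.symm
  -- `T v` and `F` are invariant under the conjugation isometries, so the projection `p` is too;
  -- being also in the image of `C(G)`, it is a class function.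
  set p := F.starProjection (T v) with hp
  have hpF : p ∈ F := Submodule.starProjection_apply_mem _ _
  obtain ⟨u, hu⟩ := hFrange hpF
  obtain ⟨s, hs⟩ := hFι hpF
  have hu' : toLTwo μ u = p := hu
  have hs' : ι s = j p := hs
  have hconj : ∀ x, conjOp μ x p = p := fun x => by
    have h1 := (conjOp μ x).map_starProjection F (T v)
    have h2 : conjOp μ x (T v) = T v := by
      rw [hT, hwc.conjOp_convOp, hv, conjOp_toLTwo, hwc.conjC_eq]
    rw [h2] at h1
    simp only [hFconj x] at h1
    exact h1
  have hclass : IsClassFunction u := isClassFunction_of_conjC_eq fun x => by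
    refine ContinuousMap.toLp_injective (p := 2) (𝕜 := ℂ) μ ?_
    change toLTwo μ (conjC x u) = toLTwo μ u
    rw [← conjOp_toLTwo, hu', hconj]
  have hsu : ι s = toLOne μ u := by rw [hs', ← hu', hj, lTwoInclusion_toLTwo]
  refine ⟨s, hsu ▸ hclass.isCentralElement, ?_⟩
  have hTg : T (a.sum fun _ x => x) ∈ F := by
    rw [Finsupp.sum, map_sum]
    refine Submodule.sum_mem _ fun c hc => ?_
    have h1 : T (a c) = c • a c := Module.End.mem_eigenspace_iff.1 (ha c)
    rw [h1]
    by_cases hc0 : c = 0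
    · rw [hc0, zero_smul]
      exact Submodule.zero_mem _
    · exact Submodule.smul_mem _ _ (Finset.le_sup (f := E) hc (hE' hc0 h1))
  have hmin : ‖T v - p‖ ≤ ‖T v - T (a.sum fun _ x => x)‖ := by
    rw [hp, Submodule.starProjection_minimal]
    exact ciInf_le (f := fun x : F => ‖T v - x‖)
      ⟨0, by rintro _ ⟨x, rfl⟩; exact norm_nonneg _⟩ ⟨_, hTg⟩
  have hjT : conv (toLOne μ w) (toLOne μ w) = j (T v) := by
    rw [hj, hT, lTwoInclusion_convOp, hv, lTwoInclusion_toLTwo]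
  rw [hjT, hs', ← map_sub]
  set y := a.sum fun _ x => x
  rw [dist_eq_norm, lt_div_iff₀ (by positivity)] at hvg
  have h1 : ‖p - T v‖ ≤ ‖T‖ * ‖v - y‖ := by
    rw [norm_sub_rev]
    refine hmin.trans ?_
    rw [← map_sub]
    exact T.le_opNorm _
  have h2 : ‖j (p - T v)‖ ≤ ‖j‖ * (‖T‖ * ‖v - y‖) :=
    (j.le_opNorm _).trans (mul_le_mul_of_nonneg_left h1 (norm_nonneg _))
  have h3 := norm_nonneg (v - y)
  nlinarith

end IsSegalAlgebra

end Spectral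
-- Diagonals and splittings over a compact group.
section CompactSegal

variable {G : Type*} [Group G] [TopologicalSpace G] [IsTopologicalGroup G]
  [MeasurableSpace G] [BorelSpace G] [CompactSpace G]
  {μ : Measure G} [μ.IsHaarMeasure]

theorem map_orbitTensor {E E' F : Type*} [NormedAddCommGroup E] [NormedSpace ℂ E]
    [NormedAddCommGroup E'] [NormedSpace ℂ E'] [NormedAddCommGroup F] [NormedSpace ℂ F]
    (T : E →L[ℂ] E') {φ : G → E} {ψ : G → F} (hφ : Continuous φ) (hψ : Continuous ψ) :
    ProjTensor.map T (ContinuousLinearMap.id ℂ F) (orbitTensor μ φ ψ)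
      = orbitTensor μ (fun z => T (φ z)) ψ := by
  rw [clm_orbitTensor _ hφ hψ, orbitTensor]
  simp

theorem conv_leftTranslate (f u : LOne μ) (x : G) :
    conv f (leftTranslate x u) = ∫ y, f y • leftTranslate (y * x) u ∂μ := by
  rw [conv_apply]
  simp only [leftTranslate_mul]

/-- Squares are needed because `exists_central_near` approximates `w * w`, not `w`. -/
theorem IsLeftApproximateUnit.map_conv_self {ℱ : Filter (LOne μ)}
    (hℱ : IsLeftApproximateUnit 1 ℱ) : IsLeftApproximateUnit 1 (ℱ.map fun w => conv w w) := by
  have := hℱ.neBot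
  refine ⟨inferInstance, ?_, fun f => ?_⟩
  · refine eventually_map.2 (hℱ.bounded.mono fun w hw => (norm_conv_le w w).trans ?_)
    exact mul_le_one₀ hw (norm_nonneg _) hw
  · refine tendsto_map'_iff.2 (tendsto_iff_norm_sub_tendsto_zero.2 ?_)
    have h1 := (tendsto_iff_norm_sub_tendsto_zero.1 (hℱ.tendsto f)).const_mul 2
    rw [mul_zero] at h1
    refine squeeze_zero' (Eventually.of_forall fun w => norm_nonneg _) ?_ h1
    filter_upwards [hℱ.bounded] with w hw
    change ‖conv (conv w w) f - f‖ ≤ 2 * ‖conv w f - f‖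
    have h2 : conv (conv w w) f - f = conv w (conv w f - f) + (conv w f - f) := by
      rw [conv_assoc, map_sub]
      abel
    have h3 : ‖conv w (conv w f - f)‖ ≤ ‖conv w f - f‖ :=
      (norm_conv_le _ _).trans (mul_le_of_le_one_left (norm_nonneg _) hw)
    rw [h2]
    exact (norm_add_le _ _).trans (by linarith)

variable [T2Space G] {S : Type*} [NormedAddCommGroup S] [NormedSpace ℂ S] {ι : S →L[ℂ] LOne μ}

variable (μ) in
theorem exists_isLeftApproximateUnit_isClassFunction :
    ∃ ℱ : Filter (LOne μ), IsLeftApproximateUnit 1 ℱ ∧ ∀ᶠ u in ℱ, ∃ w : C(G, ℂ),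
      IsClassFunction w ∧ (∀ x, starRingEnd ℂ (w x⁻¹) = w x) ∧ ‖toLOne μ w‖ ≤ 1 ∧
        toLOne μ w = u :=
  exists_isLeftApproximateUnit_of_bump
    (A := {u | ∃ w : C(G, ℂ), IsClassFunction w ∧ (∀ x, starRingEnd ℂ (w x⁻¹) = w x) ∧
      ‖toLOne μ w‖ ≤ 1 ∧ toLOne μ w = u}) fun _ hV =>
    let ⟨w, h1, h2, h3⟩ := exists_isClassFunction_isBump (μ := μ) hV
    ⟨toLOne μ w, ⟨w, h1, h2, h3.norm_le, rfl⟩, h3⟩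

namespace IsSegalAlgebra

theorem exists_isLeftApproximateUnit_central (h : IsSegalAlgebra ι) :
    ∃ ℱ : Filter (LOne μ), IsLeftApproximateUnit 2 ℱ ∧
      ∀ᶠ u in ℱ, ∃ s, IsCentralElement (ι s) ∧ ‖ι s‖ ≤ 2 ∧ ι s = u := by
  obtain ⟨ℱ, hℱ, hw⟩ := exists_isLeftApproximateUnit_isClassFunction μ
  set A := {u | ∃ s, IsCentralElement (ι s) ∧ ‖ι s‖ ≤ 2 ∧ ι s = u}
  refine ⟨_, hℱ.map_conv_self.of_mem_closure (A := A) ?_ ?_,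
    mem_inf_of_right (mem_principal_self A)⟩
  · rintro _ ⟨s, -, hs, rfl⟩
    exact hs
  · refine eventually_map.2 (hw.mono ?_)
    rintro _ ⟨w, h1, h2, h3, rfl⟩
    refine Metric.mem_closure_iff.2 fun ε hε => ?_
    -- An error below `1`, added to `‖w * w‖ ≤ 1`, accounts for the uniform bound `2`.
    obtain ⟨s, hs, hsw⟩ := h.exists_central_near h1 h2 (lt_min hε one_pos)
    refine ⟨ι s, ⟨s, hs, ?_, rfl⟩, ?_⟩
    · have h4 := norm_le_insert' (ι s) (conv (toLOne μ w) (toLOne μ w))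
      have h5 := (norm_conv_le (toLOne μ w) (toLOne μ w)).trans
        (mul_le_one₀ h3 (norm_nonneg _) h3)
      have h6 := hsw.trans_le (min_le_right _ _)
      linarith
    · rw [dist_comm, dist_eq_norm]
      exact hsw.trans_le (min_le_left _ _)

/-- The filter is turned into a net; the index set `Finset S × ℕ` lies in the universe of `S`, as
the definitions of the diagonals demand. -/
theorem exists_central_net (h : IsSegalAlgebra ι) :
    ∃ u : Finset S × ℕ → S, (∀ γ, IsCentralElement (ι (u γ)) ∧ ‖ι (u γ)‖ ≤ 2) ∧
      ∀ s, Tendsto (fun γ => h.mul (u γ) s) atTop (𝓝 s) := by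
  obtain ⟨ℱ, hℱ, hA⟩ := h.exists_isLeftApproximateUnit_central
  have := hℱ.neBot
  have key : ∀ γ : Finset S × ℕ, ∃ u : S, (IsCentralElement (ι u) ∧ ‖ι u‖ ≤ 2) ∧
      ∀ s ∈ γ.1, dist (h.mul u s) s < 1 / ((γ.2 : ℝ) + 1) := fun γ => by
    have h1 : ∀ᶠ w in ℱ, ∀ s ∈ γ.1, dist (h.leftAct w s) s < 1 / ((γ.2 : ℝ) + 1) :=
      (Finset.eventually_all γ.1).2 fun s _ =>
        Metric.tendsto_nhds.1 (h.tendsto_leftAct hℱ s) _ (by positivity)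
    obtain ⟨_, h2, u, h3, h4, rfl⟩ := (h1.and hA).exists
    exact ⟨u, ⟨h3, h4⟩, h2⟩
  choose u hu hus using key
  refine ⟨u, hu, fun s => Metric.tendsto_nhds.2 fun ε hε => ?_⟩
  obtain ⟨n, hn⟩ := exists_nat_one_div_lt hε
  filter_upwards [Ici_mem_atTop (({s}, n) : Finset S × ℕ)] with γ hγ
  refine (hus γ s (hγ.1 (Finset.mem_singleton_self s))).trans (lt_of_le_of_lt ?_ hn)
  have : (n : ℝ) ≤ γ.2 := by exact_mod_cast hγ.2
  gcongr

theorem mul_comm_of_isCentralElement (h : IsSegalAlgebra ι) {u : S}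
    (hu : IsCentralElement (ι u)) (s : S) : h.mul u s = h.mul s u :=
  h.injective (by rw [mul_spec, mul_spec, hu])

theorem tendsto_mul_mul_self (h : IsSegalAlgebra ι) {Γ : Type*} {l : Filter Γ} {u : Γ → S}
    (hu : ∀ γ, ‖ι (u γ)‖ ≤ 2) {s : S} (hs : Tendsto (fun γ => h.mul (u γ) s) l (𝓝 s)) :
    Tendsto (fun γ => h.mul (h.mul (u γ) (u γ)) s) l (𝓝 s) := by
  have h1 := (tendsto_iff_norm_sub_tendsto_zero.1 hs).const_mul 3
  rw [mul_zero] at h1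
  refine tendsto_iff_norm_sub_tendsto_zero.2 (squeeze_zero (fun _ => norm_nonneg _) (fun γ => ?_) h1)
  have h2 : h.mul (h.mul (u γ) (u γ)) s - s
      = h.leftAct (ι (u γ)) (h.mul (u γ) s - s) + (h.mul (u γ) s - s) := by
    simp only [map_sub, mul_apply, leftAct_spec, leftAct_conv]
    abel
  have h3 : ‖h.leftAct (ι (u γ)) (h.mul (u γ) s - s)‖ ≤ 2 * ‖h.mul (u γ) s - s‖ :=
    (h.norm_leftAct_le _ _).trans (mul_le_mul_of_nonneg_right (hu γ) (norm_nonneg _))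
  rw [h2]
  exact (norm_add_le _ _).trans (by linarith)

variable [CompleteSpace S]

theorem translate_mul_left (h : IsSegalAlgebra ι) (z : G) (s t : S) :
    h.translate z (h.mul s t) = h.mul (h.translate z s) t := by
  rw [mul_apply, mul_apply, translate_leftAct, translate_spec]

theorem leftAct_translate (h : IsSegalAlgebra ι) (f : LOne μ) (v : S) (x : G) :
    h.leftAct f (h.translate x v) = ∫ y, f y • h.translate (y * x) v ∂μ := by
  rw [leftAct_eq_integral]
  simp only [translate_mul]

theorem translate_leftAct_eq_integral (h : IsSegalAlgebra ι) (f : LOne μ) (v : S) (z : G) :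
    h.translate z (h.leftAct f v) = ∫ y, f y • h.translate (z * y) v ∂μ := by
  rw [map_leftAct]
  simp only [translate_mul]

/-- Centrality lets the translations cancel: `L_{z⁻¹} (u * L_z v) = L_{z⁻¹} L_z (v * u)`. Thus the
product map has a constant integrand on the diagonal tensors. -/
theorem leftAct_leftTranslate_translate (h : IsSegalAlgebra ι) {u : LOne μ}
    (hu : IsCentralElement u) (v : S) (z : G) :
    h.leftAct (leftTranslate z⁻¹ u) (h.translate z v) = h.leftAct u v := by
  refine h.injective ?_
  rw [leftAct_spec, leftAct_spec, translate_spec, conv_leftTranslate_left, hu,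
    conv_leftTranslate_left, ← leftTranslate_mul, inv_mul_cancel, leftTranslate_one, ← hu]

/-- The tensor `∫ L_{z⁻¹}u ⊗ L_z v dz` in `S ⊗̂ S`. -/
noncomputable def selfDiagonal (h : IsSegalAlgebra ι) (u v : S) : ProjTensor S S :=
  orbitTensor μ (fun z => h.translate z u) fun z => h.translate z v

theorem map_mul_selfDiagonal (h : IsSegalAlgebra ι) (s u v : S) :
    ProjTensor.map (h.mul s) (ContinuousLinearMap.id ℂ S) (h.selfDiagonal u v)
      = h.selfDiagonal u (h.mul s v) :=
  map_orbitTensor_left (ι s) _ (h.continuous_translate u) (h.continuous_translate v)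
    (h.leftAct_translate (ι s) u) (h.translate_leftAct_eq_integral (ι s) v)

theorem map_mul_flip_selfDiagonal (h : IsSegalAlgebra ι) (s u v : S) :
    ProjTensor.map (ContinuousLinearMap.id ℂ S) (h.mul.flip s) (h.selfDiagonal u v)
      = h.selfDiagonal u (h.mul v s) := by
  rw [selfDiagonal, map_orbitTensor_right _ (h.continuous_translate u) (h.continuous_translate v)]
  simp only [ContinuousLinearMap.flip_apply, ← translate_mul_left]
  rfl

theorem lift_mul_selfDiagonal (h : IsSegalAlgebra ι) {u : S} (hu : IsCentralElement (ι u)) (v : S) :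
    ProjTensor.lift h.mul (h.selfDiagonal u v) = h.mul u v :=
  lift_orbitTensor _ (h.continuous_translate u) (h.continuous_translate v) fun z => by
    rw [mul_apply, translate_spec, leftAct_leftTranslate_translate h hu, mul_apply]

theorem isPseudoContractible_of_compactSpace (h : IsSegalAlgebra ι) :
    IsPseudoContractible h.mul := by
  classical
  obtain ⟨u, hu, hlim⟩ := h.exists_central_net
  refine ⟨Finset S × ℕ, inferInstance, inferInstance, inferInstance,
    fun γ => h.selfDiagonal (u γ) (u γ), fun γ s => ?_, fun s => ?_⟩
  -- The two sides have second arguments `s * u` and `u * s`, equal by centrality of `u`.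
  · rw [map_mul_selfDiagonal, map_mul_flip_selfDiagonal,
      h.mul_comm_of_isCentralElement (hu γ).1]
  · simp only [h.lift_mul_selfDiagonal (hu _).1]
    exact h.tendsto_mul_mul_self (fun γ => (hu γ).2) (hlim s)

/-- The tensor `∫ L_{z⁻¹}u ⊗ L_z v dz` in `L¹(G) ⊗̂ S`. -/
noncomputable def diagonal (h : IsSegalAlgebra ι) (u : LOne μ) (v : S) : ProjTensor (LOne μ) S :=
  orbitTensor μ (fun z => leftTranslate z u) fun z => h.translate z v

theorem norm_diagonal_le (h : IsSegalAlgebra ι) (u : LOne μ) (v : S) :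
    ‖h.diagonal u v‖ ≤ ‖u‖ * ‖v‖ :=
  norm_orbitTensor_le (fun z => (norm_leftTranslate z u).le) fun z => h.norm_translate_le z v

theorem tensorLeft_diagonal (h : IsSegalAlgebra ι) (f u : LOne μ) (v : S) :
    h.tensorLeft f (h.diagonal u v) = h.diagonal u (h.leftAct f v) :=
  map_orbitTensor_left f _ (continuous_leftTranslate u) (h.continuous_translate v)
    (conv_leftTranslate f u) (h.translate_leftAct_eq_integral f v)

theorem map_diagonal_right (h : IsSegalAlgebra ι) {U : S →L[ℂ] S}
    (hU : ∀ z s, U (h.translate z s) = h.translate z (U s)) (u : LOne μ) (v : S) :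
    ProjTensor.map (ContinuousLinearMap.id ℂ (LOne μ)) U (h.diagonal u v)
      = h.diagonal u (U v) := by
  rw [diagonal, map_orbitTensor_right _ (continuous_leftTranslate u) (h.continuous_translate v)]
  simp only [hU]
  rfl

theorem tensorRight_diagonal (h : IsSegalAlgebra ι) (s : S) (u : LOne μ) (v : S) :
    h.tensorRight s (h.diagonal u v) = h.diagonal u (h.mul v s) :=
  h.map_diagonal_right (U := h.mul.flip s) (fun z t => (h.translate_mul_left z t s).symm) u v

theorem prodMap_diagonal (h : IsSegalAlgebra ι) {u : LOne μ} (hu : IsCentralElement u) (v : S) :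
    h.prodMap (h.diagonal u v) = h.leftAct u v :=
  lift_orbitTensor _ (continuous_leftTranslate u) (h.continuous_translate v)
    (h.leftAct_leftTranslate_translate hu v)

/-- The left action of a central `c` can be absorbed by either factor; this is what makes the limit
in `u` exist. -/
theorem diagonal_leftAct (h : IsSegalAlgebra ι) {c : LOne μ} (hc : IsCentralElement c)
    (u : LOne μ) (v : S) : h.diagonal u (h.leftAct c v) = h.diagonal (conv u c) v := by
  rw [← tensorLeft_diagonal, tensorLeft, diagonal,
    map_orbitTensor _ (continuous_leftTranslate u) (h.continuous_translate v)]
  simp only [hc _, conv_leftTranslate_left]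
  rfl

theorem hasCentralMultiplierBoundedApproximateDiagonal_of_compactSpace (h : IsSegalAlgebra ι) :
    h.HasCentralMultiplierBoundedApproximateDiagonal := by
  classical
  obtain ⟨u, hu, hlim⟩ := h.exists_central_net
  have hcomm : ∀ γ s, h.tensorLeft (ι s) (h.diagonal (ι (u γ)) (u γ))
      = h.tensorRight s (h.diagonal (ι (u γ)) (u γ)) := fun γ s => by
    rw [tensorLeft_diagonal, tensorRight_diagonal, h.mul_comm_of_isCentralElement (hu γ).1,
      mul_apply]
  have hπ : ∀ γ, h.prodMap (h.diagonal (ι (u γ)) (u γ)) = h.mul (u γ) (u γ) := fun γ =>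
    h.prodMap_diagonal (hu γ).1 (u γ)
  -- One factor `2` bounds the first tensor factor, the other bounds `u * s` in `S`. Only the `L¹`
  -- norm of `u` is controlled, so the first factor has to be `L¹(G)`.
  have hbound : ∀ γ s, ‖h.tensorRight s (h.diagonal (ι (u γ)) (u γ))‖ ≤ 4 * ‖s‖ := fun γ s => by
    rw [tensorRight_diagonal]
    have h1 : ‖h.mul (u γ) s‖ ≤ 2 * ‖s‖ := (h.norm_leftAct_le _ _).trans
      (mul_le_mul_of_nonneg_right (hu γ).2 (norm_nonneg _))
    refine (h.norm_diagonal_le _ _).trans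
      ((mul_le_mul (hu γ).2 h1 (norm_nonneg _) zero_le_two).trans_eq ?_)
    ring
  have hleft : ∀ s, Tendsto (fun γ => h.mul (h.prodMap (h.diagonal (ι (u γ)) (u γ))) s) atTop
      (𝓝 s) := fun s => by
    simp only [hπ]
    exact h.tendsto_mul_mul_self (fun γ => (hu γ).2) (hlim s)
  refine ⟨Finset S × ℕ, inferInstance, inferInstance, inferInstance,
    fun γ => h.diagonal (ι (u γ)) (u γ), ⟨hcomm, hleft, fun s => ?_⟩, 4, fun γ s => ⟨?_, hbound γ s⟩⟩
  · simp only [h.mul_prodMap_comm (hcomm _ s)]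
    exact hleft s
  · rw [hcomm]
    exact hbound γ s

/-- The map `(u, v) ↦ ∫ L_{z⁻¹}u ⊗ L_z v dz` as a bounded bilinear map. -/
noncomputable def diagonalL (h : IsSegalAlgebra ι) : LOne μ →L[ℂ] S →L[ℂ] ProjTensor (LOne μ) S :=
  have hc : ∀ (u : LOne μ) (v : S),
      Integrable (fun z => ProjTensor.tmul (leftTranslate z⁻¹ u) (h.translate z v)) μ := fun u v =>
    (continuous_tmul ((continuous_leftTranslate u).comp continuous_inv)
      (h.continuous_translate v)).integrable_of_compactGroup
  LinearMap.mkContinuous₂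
    (LinearMap.mk₂ ℂ h.diagonal
      (fun u u' v => by
        rw [diagonal, diagonal, diagonal, orbitTensor, orbitTensor, orbitTensor, ← smul_add,
          ← integral_add (hc u v) (hc u' v)]
        simp only [← leftTranslateL_apply, map_add, ProjTensor.add_tmul])
      (fun c u v => by
        rw [diagonal, diagonal, orbitTensor, orbitTensor]
        simp only [← leftTranslateL_apply, map_smul, ProjTensor.smul_tmul, integral_smul]
        rw [smul_comm])
      (fun u v v' => by
        rw [diagonal, diagonal, diagonal, orbitTensor, orbitTensor, orbitTensor, ← smul_add,
          ← integral_add (hc u v) (hc u v')]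
        simp only [map_add, ProjTensor.tmul_add])
      (fun c u v => by
        rw [diagonal, diagonal, orbitTensor, orbitTensor]
        simp only [map_smul, ProjTensor.tmul_smul, integral_smul]
        rw [smul_comm]))
    1 fun u v => by
      rw [one_mul]
      exact h.norm_diagonal_le u v

/-- Fix a central `c` with `c * v` close to `v`. Up to an error uniform in `‖u‖ ≤ 1`, the tensor for
`(u, v)` is that for `(u, c * v)`, equal to that for `(u * c, v)`, which converges to the one for
`(c, v)`. So the family is Cauchy. -/
theorem exists_tendsto_diagonal (h : IsSegalAlgebra ι) {ℱ : Filter (LOne μ)}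
    (hℱ : IsLeftApproximateUnit 1 ℱ) (hc : ∀ᶠ u in ℱ, IsCentralElement u) (v : S) :
    ∃ m, Tendsto (fun u => h.diagonal u v) ℱ (𝓝 m) := by
  have := hℱ.neBot
  refine cauchy_map_iff_exists_tendsto.1 (Metric.cauchy_iff.2 ⟨inferInstance, fun ε hε => ?_⟩)
  obtain ⟨c, hcv, hc⟩ := ((Metric.tendsto_nhds.1 (h.tendsto_leftAct hℱ v) (ε / 4)
    (by positivity)).and hc).exists
  have h1 : Tendsto (fun u => h.diagonal (conv u c) v) ℱ (𝓝 (h.diagonal c v)) :=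
    ((h.diagonalL.flip v).continuous.tendsto c).comp (hℱ.tendsto c)
  refine ⟨Metric.ball (h.diagonal c v) (ε / 2), mem_map.2 ?_, fun x hx y hy =>
    (dist_triangle_right x y (h.diagonal c v)).trans_lt ?_⟩
  · filter_upwards [Metric.tendsto_nhds.1 h1 (ε / 4) (by positivity), hℱ.bounded] with u hu hu1
    have h2 : dist (h.diagonal u v) (h.diagonal u (h.leftAct c v)) < ε / 4 := by
      have h3 : h.diagonal u v - h.diagonal u (h.leftAct c v)
          = h.diagonal u (v - h.leftAct c v) := (map_sub (h.diagonalL u) v _).symm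
      rw [dist_eq_norm, h3]
      refine (h.norm_diagonal_le _ _).trans_lt
        ((mul_le_of_le_one_left (norm_nonneg _) hu1).trans_lt ?_)
      rwa [norm_sub_rev, ← dist_eq_norm]
    rw [← h.diagonal_leftAct hc] at hu
    refine (dist_triangle _ _ _).trans_lt ((add_lt_add h2 hu).trans_eq ?_)
    ring
  · exact (add_lt_add hx hy).trans_eq (add_halves ε)

end IsSegalAlgebra

/-- The splitting is the limit of the diagonal tensors along central bumps `u`. Both module
identities already hold for each `u`, and the product map gives `u * v → v`. The bumps need not lie
in `S`. -/
theorem IsSymmetricSegalAlgebra.isProjectiveBimodule_of_compactSpace [CompleteSpace S]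
    (h : IsSymmetricSegalAlgebra ι) : h.IsProjectiveBimodule := by
  have hS := h.toIsSegalAlgebra
  obtain ⟨ℱ, hℱ, hw⟩ := exists_isLeftApproximateUnit_isClassFunction μ
  have := hℱ.neBot
  have hc : ∀ᶠ u in ℱ, IsCentralElement u := hw.mono fun u ⟨w, hwc, _, _, hwu⟩ =>
    hwu ▸ hwc.isCentralElement
  choose ρ hρ using hS.exists_tendsto_diagonal hℱ hc
  have hlin : Tendsto (fun u v => (hS.diagonalL u).toLinearMap v) ℱ (𝓝 ρ) :=
    tendsto_pi_nhds.2 hρ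
  let R := (linearMapOfTendsto ρ (fun u => (hS.diagonalL u).toLinearMap) hlin).mkContinuous 1
    fun v => by
      refine le_of_tendsto (hρ v).norm (hℱ.bounded.mono fun u hu => ?_)
      exact (hS.norm_diagonal_le u v).trans (mul_le_mul_of_nonneg_right hu (norm_nonneg v))
  have hR : ∀ v, Tendsto (fun u => hS.diagonal u v) ℱ (𝓝 (R v)) := hρ
  refine ⟨R, fun f s => ?_, fun f s => ?_, fun s => ?_⟩
  · refine tendsto_nhds_unique (hR _)
      ((((hS.tensorLeft f).continuous.tendsto _).comp (hR s)).congr fun u => ?_)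
    exact hS.tensorLeft_diagonal f u s
  · refine tendsto_nhds_unique (hR _) ((((ProjTensor.map (ContinuousLinearMap.id ℂ (LOne μ))
      (h.rightAct f)).continuous.tendsto _).comp (hR s)).congr fun u => ?_)
    refine hS.map_diagonal_right (fun z t => hS.injective ?_) u s
    rw [h.rightAct_spec, hS.translate_spec, hS.translate_spec, h.rightAct_spec,
      conv_leftTranslate_left]
  · refine tendsto_nhds_unique ((hS.prodMap.continuous.tendsto _).comp (hR s))
      ((hS.tendsto_leftAct hℱ s).congr' (hc.mono fun u hu => ?_))
    exact (hS.prodMap_diagonal hu s).symm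

end CompactSegal

/-! ### The equivalences. -/

theorem mainTheorem6 {G : Type*} [Group G] [TopologicalSpace G] [IsTopologicalGroup G]
    [LocallyCompactSpace G] [T2Space G] [MeasurableSpace G] [BorelSpace G]
    (μ : Measure G) [μ.IsHaarMeasure] [μ.Regular]
    {S : Type*} [NormedAddCommGroup S] [NormedSpace ℂ S] [CompleteSpace S]
    (ι : S →L[ℂ] LOne μ) (hS : IsSegalAlgebra ι) :
    List.TFAE [CompactSpace G,
      hS.HasCentralApproximateDiagonal,
      IsPseudoContractible hS.mul] ∧
    ∀ hsym : IsSymmetricSegalAlgebra ι,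
      List.TFAE [CompactSpace G,
        hS.HasCentralApproximateDiagonal,
        IsPseudoContractible hS.mul,
        hsym.IsProjectiveBimodule,
        hS.HasCentralMultiplierBoundedApproximateDiagonal] := by
  have h13 : CompactSpace G → IsPseudoContractible hS.mul := fun _ =>
    hS.isPseudoContractible_of_compactSpace
  have h32 : IsPseudoContractible hS.mul → hS.HasCentralApproximateDiagonal :=
    hS.hasCentralApproximateDiagonal_of_isPseudoContractible
  have h21 : hS.HasCentralApproximateDiagonal → CompactSpace G :=
    hS.compactSpace_of_hasCentralApproximateDiagonal
  refine ⟨?_, fun hsym => ?_⟩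
  · tfae_have 1 → 3 := h13
    tfae_have 3 → 2 := h32
    tfae_have 2 → 1 := h21
    tfae_finish
  · tfae_have 1 → 3 := h13
    tfae_have 3 → 2 := h32
    tfae_have 2 → 1 := h21
    tfae_have 1 → 4 := fun _ => hsym.isProjectiveBimodule_of_compactSpace
    tfae_have 4 → 1 := hsym.compactSpace_of_isProjectiveBimodule
    tfae_have 1 → 5 := fun _ =>
      hS.hasCentralMultiplierBoundedApproximateDiagonal_of_compactSpace
    tfae_have 5 → 2 := fun ⟨Γ, i1, i2, i3, m, hm, _⟩ => ⟨Γ, i1, i2, i3, m, hm⟩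
    tfae_finish
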